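/- **Setting.** Let $t=(t_1,t_3,t_5,\dots)$ be real numbers indexed by the odd positive integers, all but finitely many of them zero. On the space with basis $\phi_{a_1}\cdots\phi_{a_l}|0\rangle$ ($a_1>\cdots>a_l\ge 0$, $l\ge 0$) let the neutral fermions $\phi_a$ ($a\in\mathbb Z$) act with $\phi_a\phi_b+\phi_b\phi_a=(-1)^a\delta_{a+b,0}$ and $\phi_a|0\rangle=0$ for $a<0$; let $\langle 0|v\rangle$ be the coefficient of $|0\rangle$ in $v$, and put $H_n=\frac12\sum_{a\in\mathbb Z}(-1)^{a+1}\phi_a\phi_{-a-n}$, $H_+(t)=\sum_{n\ \mathrm{odd}}t_nH_n$. For a strict partition $\lambda=(\lambda_1>\dots>\lambda_l>0)$ of length $l(\lambda)=l$, Schur's $Q$- and $P$-functions are $$Q_\lambda(t)=2^{l/2}\langle 0|e^{H_+(2t)}\phi_{\lambda_1}\cdots\phi_{\lambda_l}|\alpha(\lambda)\rangle,\qquad P_\lambda(t)=2^{-l}Q_\lambda(t),$$ where $|\alpha(\lambda)\rangle=|0\rangle$ for $l$ even and $\sqrt2\,\phi_0|0\rangle$ for $l$ odd. The shifted Schur measure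 gives $\lambda$ the weight $$\mathbb P_{\rm SS}(\lambda;t)=\tfrac1Z P_\lambda(t)Q_\lambda(t),\qquad Z=\exp\Big(\sum_{n\ \mathrm{odd}}2n\,t_n^2\Big).$$ Let $\rho(a;t)=\mathbb P_{\rm SS}(\{\lambda: a\in\{\lambda_1,\lambda_2,\dots\}\};t)$ for integers $a\ge 1$. For $\varepsilon>0$ and $x\in\varepsilon\mathbb Z_{\ge0}$ let $\psi_{\lambda,\varepsilon}(x)=x+2\varepsilon\,\#\{i: x<\lambda_i\varepsilon\}$ be the rescaled profile of the shifted Young diagram of $\lambda$, and let $\mathbb E$ be the expectation under $\mathbb P_{\rm SS}(\,\cdot\,;t/\varepsilon)$. Put $$D(\theta)=4\sum_{n\ \mathrm{odd}}n\,t_n\cos n\theta,\qquad b=D(0)=4\sum_{n\ \mathrm{odd}}n\,t_n.$$ **Theorem 4.1.** Suppose that $4\sum_{n\ \mathrm{odd}}n^2t_n\sin n\theta>0$ for all $\theta\in(0,\pi)$. Then $\mathbb P_{\rm SS}(\,\cdot\,;t/\varepsilon)$ is a probability measure for every $\varepsilon>0$, and for every $x\in[-b,b]$ there is exactly one $\chi(x)\in[0,\pi]$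 with $D(\chi(x))=x$. Let $x\ge0$. For every $\varepsilon>0$ with $x/\varepsilon\in\mathbb Z$ the series $\sum_{k\ge1}\rho(\frac x\varepsilon+k;\frac t\varepsilon)$ converges and $\psi_{\lambda,\varepsilon}(x)$ is integrable. As $\varepsilon\to0$ through positive values with $x/\varepsilon\in\mathbb Z$, $$\lim_{\varepsilon\to0}2\varepsilon\sum_{k=1}^\infty\rho\Big(\frac x\varepsilon+k;\frac t\varepsilon\Big)=\begin{cases}\dfrac2\pi\displaystyle\int_0^{\chi(x)}(D(\theta)-x)\,d\theta & 0\le x\le b,\\[2mm] 0 & b\le x,\end{cases}$$ and the limit shape is $$\lim_{\varepsilon\to0}\mathbb E[\psi_{\lambda,\varepsilon}(x)]=\begin{cases}x+\dfrac2\pi\displaystyle\int_0^{\chi(x)}(D(\theta)-x)\,d\theta & 0\le x\le b,\\[2mm] x & b\le x.\end{cases}$$ -/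

import Mathlib

open MeasureTheory Filter Topology Set

namespace ShiftedSchur

noncomputable section

/-- Miwa variables `t = (t₁, t₃, t₅, …)`: a real number `t n` for each odd natural number `n`,
all but finitely many of them zero. -/
abbrev Miwa : Type := {n : ℕ // Odd n} →₀ ℝ

/-! ### Neutral fermions -/

/-- The Fock space of neutral fermions, the exterior algebra on `e₀, e₁, e₂, …`. It is given by its
basis of wedges: the basis vector `ket S` indexed by a finite set `S = {a₁ > ⋯ > a_l}` of natural
numbers is `e_{a_l} ∧ ⋯ ∧ e_{a₁} = φ_{a₁} ⋯ φ_{a_l} |0⟩`. -/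
abbrev Fock : Type := Finset ℕ →₀ ℝ

/-- The basis vector of the Fock space indexed by `S`. -/
def ket (S : Finset ℕ) : Fock := Finsupp.single S 1

/-- The vacuum state `|0⟩`. -/
def vacuum : Fock := ket ∅

/-- The vacuum functional `v ↦ ⟨0|v⟩`: the coefficient of `|0⟩`. -/
def vacuumFunctional : Fock →ₗ[ℝ] ℝ := Finsupp.lapply ∅

/-- The sign picked up by a fermion of index `a` on its way past the elements of `S` that are
larger than `a`. -/
def passSign (a : ℕ) (S : Finset ℕ) : ℝ := (-1) ^ (S.filter (fun b => a < b)).card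

/-- The action of `φ_a` on the basis vector `ket S`. For `a > 0` it creates a particle at `a`, for
`a < 0` it annihilates a particle at `-a` and multiplies by `(-1)^a`, and `φ₀` creates a particle
at `0` or, if there is one, annihilates it with a factor `1/2`, so that `φ₀² = 1/2`. These are the
rules forced by `[φ_a, φ_b]₊ = (-1)^a δ_{a+b,0}` and by `φ_a |0⟩ = 0` for `a < 0`. -/
def fermionOnKet (a : ℤ) (S : Finset ℕ) : Fock :=
  if a.natAbs ∈ S then
    if 0 < a then 0
    else
      (passSign a.natAbs S * (if a = 0 then 1 / 2 else (-1) ^ a.natAbs)) • ket (S.erase a.natAbs)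
  else
    if 0 ≤ a then passSign a.natAbs S • ket (insert a.natAbs S)
    else 0

/-- The neutral fermion `φ_a`, `a ∈ ℤ`, as an operator on the Fock space. -/
def fermion (a : ℤ) : Module.End ℝ Fock := Finsupp.linearCombination ℝ (fermionOnKet a)

/-- The operator `H_n = (1/2) ∑_{a ∈ ℤ} (-1)^(a+1) φ_a φ_{-a-n}`. It is used for `n ≥ 1` only, where
all but finitely many terms of the sum vanish on each basis vector. -/
def hamiltonian (n : ℕ) : Module.End ℝ Fock :=
  Finsupp.linearCombination ℝ fun S =>
    (1 / 2 : ℝ) • ∑ᶠ a : ℤ, ((-1 : ℝ) ^ (a + 1)) • fermion a (fermion (-a - n) (ket S))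

/-- `H₊(t) = ∑_{n ≥ 1 odd} t_n H_n`. -/
def hPlus (t : Miwa) : Module.End ℝ Fock := t.sum fun n c => c • hamiltonian n

/-- `⟨0| e^{H₊(t)} |v⟩`. As `H₊(t)` lowers the energy, all but finitely many terms of the
exponential series vanish. -/
def expVacuum (t : Miwa) (v : Fock) : ℝ :=
  ∑' k : ℕ, ((k.factorial : ℝ))⁻¹ * vacuumFunctional ((hPlus t ^ k) v)

/-! ### Strict partitions and Schur's `P`- and `Q`-functions -/

/-- A strict partition `λ₁ > ⋯ > λ_l > 0`, given by its set of parts. -/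
@[ext]
structure StrictPartition where
  /-- the set of parts -/
  parts : Finset ℕ
  pos : ∀ a ∈ parts, 0 < a

/-- Every set of strict partitions is measurable. -/
instance : MeasurableSpace StrictPartition := ⊤

/-- The length `l(λ)`. -/
def StrictPartition.length (p : StrictPartition) : ℕ := p.parts.card

/-- The state `|α(λ)⟩`: it is `|0⟩` if `l(λ)` is even, and `|1⟩ = √2 φ₀ |0⟩` if `l(λ)` is odd. -/
def parityState (p : StrictPartition) : Fock :=
  if Even p.length then vacuum else √2 • fermion 0 vacuum

/-- The even state `φ_{λ₁} ⋯ φ_{λ_l} |α(λ)⟩`. -/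
def partitionState (p : StrictPartition) : Fock :=
  (((p.parts.sort (fun a b => a ≥ b)).map fun a : ℕ => fermion a).prod) (parityState p)

/-- Schur's `Q`-function `Q_λ(t) = 2^(l(λ)/2) ⟨0| e^{H₊(2t)} φ_{λ₁} ⋯ φ_{λ_l} |α(λ)⟩`. -/
def schurQ (p : StrictPartition) (t : Miwa) : ℝ :=
  √2 ^ p.length * expVacuum ((2 : ℝ) • t) (partitionState p)

/-- Schur's `P`-function `P_λ(t) = 2^(-l(λ)) Q_λ(t)`. -/
def schurP (p : StrictPartition) (t : Miwa) : ℝ := schurQ p t / 2 ^ p.length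

/-! ### The shifted Schur measure -/

/-- `Z = exp (∑_{n odd} 2 n t_n²)`. -/
def partitionFunction (t : Miwa) : ℝ := Real.exp (t.sum fun n c => 2 * (n : ℝ) * c ^ 2)

/-- The shifted Schur measure, with `λ` having the probability `P_λ(t) Q_λ(t) / Z`; for real `t`
there is no complex conjugation, and the weights are non-negative as `P_λ Q_λ = 2^(-l) Q_λ²`. -/
def shiftedSchurMeasure (t : Miwa) : Measure StrictPartition :=
  Measure.sum fun p =>
    ENNReal.ofReal (schurP p t * schurQ p t / partitionFunction t) • Measure.dirac p

/-- The correlation function `ρ(A; t)`, the probability that all elements of `A` are parts. -/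
def rho (A : Finset ℕ) (t : Miwa) : ℝ :=
  (shiftedSchurMeasure t).real {p : StrictPartition | A ⊆ p.parts}

/-- The profile `ψ_{λ,ε}(x) = x + 2 ε #{i | x < λ_i ε}` of the shifted Young diagram with
boxes rescaled by `ε`. -/
def profile (p : StrictPartition) (ε x : ℝ) : ℝ :=
  x + 2 * ε * ((p.parts.filter fun a : ℕ => x < a * ε).card : ℝ)

/-- The mesh sizes `ε > 0` for which `x` is a lattice point, `x ∈ ε ℤ_{≥ 0}`. -/
def meshSizes (x : ℝ) : Set ℝ := {ε : ℝ | 0 < ε ∧ ∃ m : ℕ, x = m * ε}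

/-- `D(θ) = 4 ∑_{n odd} n t_n cos (n θ)`. -/
def dispersion (t : Miwa) (θ : ℝ) : ℝ := 4 * t.sum fun n c => (n : ℝ) * c * Real.cos (n * θ)

/-- `b = 4 ∑_{n odd} n t_n`. -/
def edge (t : Miwa) : ℝ := 4 * t.sum fun n c => (n : ℝ) * c

/-- Non-degeneracy: `4 ∑_{n odd} n² t_n sin (n θ) > 0` for all `θ ∈ (0, π)`. -/
def NonDegenerate (t : Miwa) : Prop :=
  ∀ θ ∈ Ioo 0 Real.pi, 0 < 4 * t.sum fun n c => (n : ℝ) ^ 2 * c * Real.sin (n * θ)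

end

end ShiftedSchur

open ShiftedSchur

/-!
The shifted Schur measure is the distribution of the occupied sites of a vector in the Fock space of
neutral fermions, and this vector is a fermionic vacuum in disguise, so that all its one-point
functions can be computed.

Give the Fock space the inner product for which the adjoint of `φ_a` is `(-1)^a φ_{-a}`, and let
`H₋(t) = ∑ t_n H_{-n}` be the adjoint of `H₊(t)`. In the completion `ℓ²` the coherent state
`u = e^{H₋(2t)} |0⟩` represents the functional `⟨0| e^{H₊(2t)}`, so that `P_λ(t) Q_λ(t)` is the
squared modulus of the coordinate of `u` at the even state attached to `λ` (`schurP_mul_schurQ`).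
The currents satisfy `[H₊, H₋] = const` (`hPlus_raising`), which gives `‖u‖² = Z`: the total mass is
one. Likewise `ρ(a) = ‖φ_a† u‖² / Z`.

Conjugation by `e^{H₋}` convolves the fermion field with the coefficients of an exponential of a
Laurent polynomial. Hence the transform `e^{-∑ 2 t_n (σ^n - σ^{-n})}` of the sequence `φ_a† u`, with
`σ` the shift, vanishes at positive indices (`dressedState_of_pos`), and the anticommutation
relations survive because the kernel `J` of the transform is orthonormal (`inner_bogoliubov_add`).
The transformed vectors therefore have `Z` times the Gram matrix of the `φ_a† |0⟩`, and inverting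
the transform gives `ρ(a) = J_a² / 2 + ∑_{j > a} J_j²` (`hasSum_rho`), where the `J_j` are the
Fourier coefficients of `e^{i g(θ)}` with `g(θ) = 4 ∑ t_n sin (n θ)`. Summing over `a`, the expected
number of parts larger than `m` is `∑_{j > m} (j - m - 1/2) J_j²` (`hasSum_rho_tail`).

By Parseval the `J_j²` sum to one and have the characteristic function
`s ↦ (2π)⁻¹ ∫ exp (i (g(θ + s) - g(θ))) dθ`. With `t / ε` for `t` and `ε s` for `s` it tends to
`(2π)⁻¹ ∫ exp (i s g'(θ)) dθ` as `ε → 0`. As `g' = D`, Lévy's continuity theorem shows that under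
the weights `J_j²` the law of `ε j` tends to the law of `D(θ)` at a uniformly distributed angle `θ`.
The second moments are bounded, so that the means of `(ε j - x)₊` converge as well
(`tendsto_tsum_posPart`), and `2 ε ∑ ρ` tends to `(2 / π) ∫₀^π (D(θ) - x)₊ dθ`; the shift by `1/2`
costs at most `ε`. Non-degeneracy says that `D` decreases strictly on `[0, π]`, from `b` to `-b`,
and so the positive part cuts this integral off at `χ(x)`.
-/

namespace ShiftedSchur

noncomputable section

open scoped symmDiff Nat BoundedContinuousFunction

/-! ### Neutral fermions on the Fock space -/

lemma single_eq_smul_ket (S : Finset ℕ) (c : ℝ) : (Finsupp.single S c : Fock) = c • ket S := by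
  simp [ket]

lemma ket_induction {p : Fock → Prop} (v : Fock) (h0 : p 0) (hadd : ∀ v w, p v → p w → p (v + w))
    (hket : ∀ (c : ℝ) S, p (c • ket S)) : p v := by
  induction v using Finsupp.induction_linear with
  | zero => exact h0
  | add f g hf hg => exact hadd f g hf hg
  | single S c => rw [single_eq_smul_ket]; exact hket c S

lemma linearMap_ext_ket {M : Type*} [AddCommMonoid M] [Module ℝ M] {f g : Fock →ₗ[ℝ] M}
    (h : ∀ S, f (ket S) = g (ket S)) : f = g := by
  refine LinearMap.ext fun v => ?_
  induction v using ket_induction with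
  | h0 => simp
  | hadd v w hv hw => rw [map_add, map_add, hv, hw]
  | hket c S => rw [map_smul, map_smul, h]

lemma passSign_symmDiff (a b : ℕ) (S : Finset ℕ) :
    passSign a (S ∆ {b}) = passSign a S * (if a < b then -1 else 1) := by
  have key : ∀ T : Finset ℕ, passSign a T = ∏ c ∈ T, (if a < c then (-1 : ℝ) else 1) := by
    intro T
    rw [passSign, Finset.prod_ite]
    simp
  rw [key, key]
  by_cases hb : b ∈ S
  · have : S ∆ {b} = S.erase b := by ext x; simp [Finset.mem_symmDiff]; grind
    rw [this, ← Finset.prod_erase_mul _ _ hb, mul_assoc]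
    split_ifs <;> simp
  · have : S ∆ {b} = insert b S := by ext x; simp [Finset.mem_symmDiff]; grind
    rw [this, Finset.prod_insert hb, mul_comm]

lemma passSign_mul_self (a : ℕ) (S : Finset ℕ) : passSign a S * passSign a S = 1 := by
  rw [passSign, ← pow_add, ← two_mul, pow_mul]; simp

lemma negOnePow_natAbs (a : ℤ) : (-1 : ℝ) ^ a.natAbs = (-1 : ℝ) ^ a := by
  rcases Int.natAbs_eq a with h | h
  · conv_rhs => rw [h, zpow_natCast]
  · conv_rhs => rw [h, zpow_neg, zpow_natCast, ← inv_pow]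
    norm_num

lemma negOnePow_mul_self (a : ℤ) : (-1 : ℝ) ^ a * (-1 : ℝ) ^ a = 1 := by
  rw [← mul_zpow]; simp

lemma negOnePow_neg (a : ℤ) : (-1 : ℝ) ^ (-a) = (-1 : ℝ) ^ a := by
  rw [zpow_neg, ← inv_zpow]; norm_num

lemma negOnePow_inv (a : ℤ) : ((-1 : ℝ) ^ a)⁻¹ = (-1 : ℝ) ^ a := by
  rw [← zpow_neg, negOnePow_neg]

/-- The part of the matrix element of `φ_a` that does not depend on the ordering of the fermions;
`occ` tells whether there is a particle at `|a|`. -/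
def occupationFactor (a : ℤ) (occ : Prop) [Decidable occ] : ℝ :=
  if occ then (if 0 < a then 0 else if a = 0 then 1 / 2 else (-1 : ℝ) ^ a)
  else if 0 ≤ a then 1 else 0

/-- The matrix element of `φ_a` between `ket S` and `ket (S ∆ {|a|})`. -/
def flipCoeff (a : ℤ) (S : Finset ℕ) : ℝ :=
  passSign a.natAbs S * occupationFactor a (a.natAbs ∈ S)

/-- Every neutral fermion flips the occupation of one site. -/
lemma fermion_ket (a : ℤ) (S : Finset ℕ) :
    fermion a (ket S) = flipCoeff a S • ket (S ∆ {a.natAbs}) := by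
  have h : fermion a (ket S) = fermionOnKet a S := by
    simp [fermion, ket, Finsupp.linearCombination_single]
  rw [h, fermionOnKet, flipCoeff, occupationFactor]
  by_cases hb : a.natAbs ∈ S
  · have : S ∆ {a.natAbs} = S.erase a.natAbs := by ext x; simp [Finset.mem_symmDiff]; grind
    simp only [hb, if_true, this, negOnePow_natAbs]
    split_ifs <;> simp
  · have : S ∆ {a.natAbs} = insert a.natAbs S := by ext x; simp [Finset.mem_symmDiff]; grind
    simp only [hb, if_false, this]
    split_ifs <;> simp

/-- The canonical anticommutation relations. -/
theorem fermion_anticomm (a b : ℤ) (v : Fock) :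
    fermion a (fermion b v) + fermion b (fermion a v)
      = (if a + b = 0 then (-1 : ℝ) ^ a else 0) • v := by
  induction v using ket_induction with
  | h0 => simp
  | hadd v w hv hw => simp only [map_add, smul_add, ← hv, ← hw]; abel
  | hket c S =>
    simp only [map_smul]
    rw [← smul_add, smul_comm _ c]
    congr 1
    rw [fermion_ket, fermion_ket, map_smul, map_smul, fermion_ket, fermion_ket, smul_smul, smul_smul,
      symmDiff_right_comm S {b.natAbs}, ← add_smul]
    by_cases hab : a.natAbs = b.natAbs
    · have hS : S ∆ {a.natAbs} ∆ {b.natAbs} = S := by rw [hab]; simp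
      rw [hS]
      congr 1
      simp only [flipCoeff, hab, passSign_symmDiff]
      have h1 : b.natAbs ∈ S ∆ {b.natAbs} ↔ b.natAbs ∉ S := by simp [Finset.mem_symmDiff]
      have h2 := passSign_mul_self b.natAbs S
      have h3 : ∀ x y : ℝ, passSign b.natAbs S * x *
          (passSign b.natAbs S * (if b.natAbs < b.natAbs then -1 else 1) * y) = x * y := by
        intro x y; rw [if_neg (lt_irrefl _)]; linear_combination (x * y) * h2
      rw [h3, h3]
      simp only [occupationFactor, h1]
      rcases Int.natAbs_eq_natAbs_iff.1 hab with h | h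
      · subst h
        rcases lt_trichotomy a 0 with h0 | h0 | h0
        · by_cases hm : a.natAbs ∈ S <;> simp [hm, h0.not_gt, h0.ne, h0.not_ge,
            show ¬ (a + a = 0) by omega]
        · subst h0
          by_cases hm : 0 ∈ S <;> simp [hm] <;> norm_num
        · by_cases hm : a.natAbs ∈ S <;> simp [hm, h0, h0.le, show ¬ (a + a = 0) by omega]
      · subst h
        have e : (-1 : ℝ) ^ (-b) = (-1 : ℝ) ^ b := negOnePow_neg b
        rcases lt_trichotomy b 0 with h0 | h0 | h0
        · by_cases hm : b.natAbs ∈ S <;> simp [hm, h0, h0.le, h0.not_gt, h0.ne, h0.not_ge,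
            negOnePow_inv]
        · subst h0
          by_cases hm : 0 ∈ S <;> simp [hm] <;> norm_num
        · by_cases hm : b.natAbs ∈ S <;> simp [hm, h0, h0.le, h0.not_gt, h0.ne', h0.not_ge]
    · have hab' : ¬ (a + b = 0) := by omega
      rw [if_neg hab', zero_smul]
      convert zero_smul ℝ (ket (S ∆ {a.natAbs} ∆ {b.natAbs})) using 2
      simp only [flipCoeff, passSign_symmDiff]
      have h1 : a.natAbs ∈ S ∆ {b.natAbs} ↔ a.natAbs ∈ S := by simp [Finset.mem_symmDiff, hab]
      have h2 : b.natAbs ∈ S ∆ {a.natAbs} ↔ b.natAbs ∈ S := by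
        simp [Finset.mem_symmDiff, Ne.symm hab]
      simp only [occupationFactor, h1, h2]
      rcases lt_or_gt_of_ne hab with h | h
      · rw [if_pos h, if_neg h.not_gt]; ring
      · rw [if_pos h, if_neg h.not_gt]; ring

lemma fermion_vacuum_of_neg {a : ℤ} (ha : a < 0) : fermion a vacuum = 0 := by
  rw [vacuum, fermion_ket]
  simp [flipCoeff, occupationFactor, ha.not_ge]

/-- The Fock space is generated from the vacuum by the fermions: `ket S` with a largest element `a`
adjoined is `φ_a (ket S)`. -/
lemma ket_insert_of_max {a : ℕ} {S : Finset ℕ} (h : ∀ x ∈ S, x < a) :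
    ket (insert a S) = fermion a (ket S) := by
  have ha : a ∉ S := fun h' => lt_irrefl _ (h a h')
  rw [fermion_ket]
  have : S ∆ {a} = insert a S := by ext x; simp [Finset.mem_symmDiff]; grind
  have h2 : S.filter (fun b => a < b) = ∅ := by
    ext x; simp; intro hx; exact (h x hx).le
  simp [flipCoeff, occupationFactor, this, passSign, h2, ha]

/-! ### The inner product on the Fock space -/

/-- The squared length of `ket S`: since `φ₀² = 1/2`, the vector `φ₀|0⟩` has squared length `1/2`.
-/
def ketNormSq (S : Finset ℕ) : ℝ := if 0 ∈ S then 1 / 2 else 1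

lemma ketNormSq_pos (S : Finset ℕ) : 0 < ketNormSq S := by
  rw [ketNormSq]; split_ifs <;> norm_num

/-- The Hilbert space `ℓ²` on the finite sets of natural numbers, the completion of the Fock
space. -/
abbrev FockL2 : Type := lp (fun _ : Finset ℕ => ℝ) 2

/-- The embedding of the Fock space into its completion; the basis vector at `S` is the normalised
`ket S`. -/
def toL2 : Fock →ₗ[ℝ] FockL2 :=
  Finsupp.linearCombination ℝ fun S => √(ketNormSq S) • (lp.single 2 S (1 : ℝ) : FockL2)

lemma toL2_ket (S : Finset ℕ) : toL2 (ket S) = √(ketNormSq S) • (lp.single 2 S (1 : ℝ) : FockL2) := by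
  simp [toL2, ket, Finsupp.linearCombination_single]

lemma inner_toL2_ket_right (x : FockL2) (S : Finset ℕ) :
    inner ℝ x (toL2 (ket S)) = √(ketNormSq S) * x S := by
  rw [toL2_ket, inner_smul_right, lp.inner_single_right]
  simp

/-- The inner product on the Fock space for which the kets are orthogonal and `φ_a` has the adjoint
`(-1)^a φ_{-a}`. -/
def fockInner : Fock →ₗ[ℝ] Fock →ₗ[ℝ] ℝ := (innerₗ FockL2).compl₁₂ toL2 toL2

lemma fockInner_apply (v w : Fock) : fockInner v w = inner ℝ (toL2 v) (toL2 w) := rfl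

lemma fockInner_symm (v w : Fock) : fockInner v w = fockInner w v := by
  simp only [fockInner_apply]; exact real_inner_comm _ _

lemma fockInner_ket (S T : Finset ℕ) :
    fockInner (ket S) (ket T) = if S = T then ketNormSq T else 0 := by
  rw [fockInner_apply, inner_toL2_ket_right, toL2_ket]
  split_ifs with h
  · subst h
    simp [Real.mul_self_sqrt (ketNormSq_pos S).le]
  · simp [lp.single_apply, Ne.symm h]

lemma fockInner_vacuum (v : Fock) : fockInner vacuum v = vacuumFunctional v := by
  induction v using ket_induction with
  | h0 => simp
  | hadd v w hv hw => simp [hv, hw]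
  | hket c S =>
    rw [map_smul, map_smul, vacuum, fockInner_ket]
    by_cases h : ∅ = S
    · subst h; simp [vacuumFunctional, ket, ketNormSq]
    · simp [vacuumFunctional, ket, h]

lemma eq_zero_of_fockInner_ket {v : Fock} {S : Finset ℕ} (h : fockInner (ket S) v = 0) : v S = 0 := by
  have key : ∀ w : Fock, fockInner (ket S) w = ketNormSq S * w S := by
    intro w
    induction w using ket_induction with
    | h0 => simp
    | hadd v w hv hw => simp [hv, hw]; ring
    | hket c T =>
      rw [map_smul, fockInner_ket]
      by_cases h : S = T
      · subst h; simp [ket]; ring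
      · simp [ket, h]
  rw [key] at h
  exact (mul_eq_zero.1 h).resolve_left (ketNormSq_pos S).ne'

/-- The adjoint of `φ_a` is `(-1)^a φ_{-a}`. -/
theorem fockInner_fermion_left (a : ℤ) (v w : Fock) :
    fockInner (fermion a v) w = (-1 : ℝ) ^ a * fockInner v (fermion (-a) w) := by
  induction v using ket_induction with
  | h0 => simp
  | hadd v v' hv hv' => simp [hv, hv', mul_add]
  | hket c S =>
    induction w using ket_induction with
    | h0 => simp
    | hadd w w' hw hw' => simp only [map_add, hw, hw', mul_add]
    | hket d T =>
      simp only [map_smul, LinearMap.smul_apply, smul_eq_mul]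
      suffices h : fockInner (fermion a (ket S)) (ket T)
          = (-1 : ℝ) ^ a * fockInner (ket S) (fermion (-a) (ket T)) by rw [h]; ring
      rw [fermion_ket, fermion_ket, map_smul, map_smul, LinearMap.smul_apply, fockInner_ket,
        fockInner_ket, Int.natAbs_neg]
      by_cases hT : S ∆ {a.natAbs} = T
      · have hS : S = T ∆ {a.natAbs} := by rw [← hT]; simp
        rw [if_pos hT, if_pos hS]
        subst hT
        simp only [symmDiff_symmDiff_cancel_right, flipCoeff, passSign_symmDiff, Int.natAbs_neg,
          lt_irrefl, if_false, mul_one, smul_eq_mul]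
        have h1 : a.natAbs ∈ S ∆ {a.natAbs} ↔ a.natAbs ∉ S := by simp [Finset.mem_symmDiff]
        simp only [occupationFactor, h1, ketNormSq]
        have e := negOnePow_mul_self a
        have h2 : a ≠ 0 → (0 ∈ S ∆ {a.natAbs} ↔ 0 ∈ S) := by
          intro h
          have h' : 0 ≠ a.natAbs := by omega
          simp [Finset.mem_symmDiff, h']
        rcases lt_trichotomy a 0 with h0 | h0 | h0
        · by_cases hm : a.natAbs ∈ S <;> simp [hm, h0, h0.le, h0.not_gt, h0.ne, h0.not_ge, h2 h0.ne]
          split_ifs <;> ring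
        · subst h0
          by_cases hm : 0 ∈ S <;> simp [hm, Finset.mem_symmDiff]
        · by_cases hm : a.natAbs ∈ S <;> simp only [hm, h0, h0.le, h0.ne', h0.not_ge, if_true,
            if_false, not_true, not_false_iff, h2 h0.ne', negOnePow_neg,
            neg_eq_zero, neg_nonneg, neg_pos, h0.not_gt, mul_zero, zero_mul]
          linear_combination (-(passSign a.natAbs S * if 0 ∈ S then (1 / 2 : ℝ) else 1)) * e
      · have hS : S ≠ T ∆ {a.natAbs} := by rintro rfl; simp at hT
        rw [if_neg hT, if_neg hS]; simp

/-! ### Bosonic currents -/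

/-- The current `H_n` for an arbitrary integer `n`; for `n ≥ 1` it is `hamiltonian n`, and negative
indices give the adjoint, raising operators. For `n = 0` the sum is infinite, and the value has no
meaning. -/
def current (n : ℤ) : Module.End ℝ Fock :=
  Finsupp.linearCombination ℝ fun S =>
    (1 / 2 : ℝ) • ∑ᶠ a : ℤ, ((-1 : ℝ) ^ (a + 1)) • fermion a (fermion (-a - n) (ket S))

lemma hamiltonian_eq_current (n : ℕ) : hamiltonian n = current n := rfl

lemma eventually_fermion_eq_zero (v : Fock) :
    ∀ᶠ A : ℤ in atTop, ∀ a ≤ -A, fermion a v = 0 := by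
  induction v using ket_induction with
  | h0 => simp
  | hadd v w hv hw =>
    filter_upwards [hv, hw] with A h1 h2 a ha
    rw [map_add, h1 a ha, h2 a ha, add_zero]
  | hket c S =>
    filter_upwards [eventually_ge_atTop ((S.sup id : ℕ) + 1 : ℤ)] with A hA a ha
    have h1 : a.natAbs ∉ S := by
      intro h
      have := Finset.le_sup (f := id) h
      simp only [id] at this
      omega
    have h2 : ¬ (0 ≤ a) := by omega
    rw [map_smul, fermion_ket]
    simp [flipCoeff, occupationFactor, h1, h2]

lemma fermion_swap {a b : ℤ} (h : a + b ≠ 0) (v : Fock) :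
    fermion a (fermion b v) = -fermion b (fermion a v) := by
  have := fermion_anticomm a b v
  rw [if_neg h, zero_smul] at this
  exact eq_neg_of_add_eq_zero_left this

lemma eventually_quadratic_eq_zero {n : ℤ} (hn : n ≠ 0) (v : Fock) :
    ∀ᶠ A : ℤ in atTop, ∀ a ∉ Finset.Icc (-A) A, fermion a (fermion (-a - n) v) = 0 := by
  obtain ⟨B, hB⟩ := (eventually_fermion_eq_zero v).exists
  filter_upwards [eventually_ge_atTop (|B| + |n|)] with A hA a ha
  have e1 := le_abs_self B
  have e2 := le_abs_self n
  have e3 := neg_abs_le n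
  have e4 := abs_nonneg n
  simp only [Finset.mem_Icc, not_and_or, not_le] at ha
  rcases ha with ha | ha
  · rw [fermion_swap (by omega), hB a (by omega)]; simp
  · rw [hB (-a - n) (by omega), map_zero]

/-- On a given vector the sum that defines a current can be truncated to a large symmetric
interval. -/
lemma eventually_current_eq_sum {n : ℤ} (hn : n ≠ 0) (v : Fock) :
    ∀ᶠ A : ℤ in atTop, current n v = (1 / 2 : ℝ) •
      ∑ a ∈ Finset.Icc (-A) A, ((-1 : ℝ) ^ (a + 1)) • fermion a (fermion (-a - n) v) := by
  induction v using ket_induction with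
  | h0 => simp
  | hadd v w hv hw =>
    filter_upwards [hv, hw] with A h1 h2
    rw [map_add, h1, h2, ← smul_add, ← Finset.sum_add_distrib]
    simp
  | hket c S =>
    filter_upwards [eventually_quadratic_eq_zero hn (ket S)] with A h
    have e : current n (ket S) = (1 / 2 : ℝ) • ∑ᶠ a : ℤ,
        ((-1 : ℝ) ^ (a + 1)) • fermion a (fermion (-a - n) (ket S)) := by
      simp [current, ket, Finsupp.linearCombination_single]
    rw [map_smul, e, finsum_eq_sum_of_support_subset (s := Finset.Icc (-A) A), smul_comm c,
      Finset.smul_sum]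
    · simp only [map_smul, smul_comm c]
    · intro a ha
      by_contra h'
      exact ha (by simp only [h a (by simpa using h'), smul_zero])

lemma quadratic_fermion (a c b : ℤ) (v : Fock) :
    fermion a (fermion c (fermion b v)) = fermion b (fermion a (fermion c v))
      + (if c = -b then (-1 : ℝ) ^ c else 0) • fermion a v
      - (if a = -b then (-1 : ℝ) ^ a else 0) • fermion c v := by
  have h1 := congrArg (fermion a) (fermion_anticomm c b v)
  have h2 := fermion_anticomm a b (fermion c v)
  rw [map_add, map_smul] at h1
  simp only [add_eq_zero_iff_eq_neg] at h1 h2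
  rw [eq_sub_of_add_eq h1, eq_sub_of_add_eq h2]
  abel

/-- The fermions are shifted by the currents: `[H_n, φ_b] = φ_{b-n}` for odd `n`. -/
theorem current_fermion {n : ℤ} (hn : Odd n) (b : ℤ) (v : Fock) :
    current n (fermion b v) = fermion b (current n v) + fermion (b - n) v := by
  have hn0 : n ≠ 0 := by rintro rfl; simp at hn
  obtain ⟨A, h1, h2, hA⟩ := ((eventually_current_eq_sum hn0 (fermion b v)).and
    ((eventually_current_eq_sum hn0 v).and (eventually_ge_atTop (|b| + |n|)))).exists
  have e1 := le_abs_self b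
  have e2 := le_abs_self n
  have e3 := neg_abs_le n
  have e4 := neg_abs_le b
  have hnn : (-1 : ℝ) ^ n = -1 := hn.neg_one_zpow
  -- Two terms of the sum fail to commute with `φ_b`, and each contributes half of `φ_{b-n}`.
  have t1 : ∀ a : ℤ, ((-1 : ℝ) ^ (a + 1)) • fermion a (fermion (-a - n) (fermion b v))
      = fermion b (((-1 : ℝ) ^ (a + 1)) • fermion a (fermion (-a - n) v))
        + (if a = b - n then fermion (b - n) v else 0)
        + (if a = -b then fermion (b - n) v else 0) := by
    intro a
    rw [quadratic_fermion, smul_sub, smul_add, map_smul, sub_eq_add_neg]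
    congr 1
    · congr 1
      by_cases h : a = b - n
      · subst h
        rw [if_pos (by ring), if_pos rfl, smul_smul, ← zpow_add₀ (by norm_num),
          show b - n + 1 + (-(b - n) - n) = -b + (b - n + 1) by ring, zpow_add₀ (by norm_num),
          zpow_add₀ (by norm_num), zpow_sub₀ (by norm_num), hnn, negOnePow_neg]
        have := negOnePow_mul_self b
        convert one_smul ℝ _
        simp only [zpow_one]
        linear_combination this
      · rw [if_neg (by omega), if_neg h, zero_smul, smul_zero]
    · by_cases h : a = -b
      · subst h
        rw [if_pos rfl, if_pos rfl, smul_smul, zpow_add₀ (by norm_num), negOnePow_neg,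
          ← neg_smul, show - -b - n = b - n by ring]
        have := negOnePow_mul_self b
        convert one_smul ℝ _
        simp only [zpow_one]
        linear_combination this
      · rw [if_neg h, if_neg h, zero_smul, smul_zero, neg_zero]
  rw [h1, h2, Finset.sum_congr rfl fun a _ => t1 a, Finset.sum_add_distrib, Finset.sum_add_distrib,
    Finset.sum_ite_eq', Finset.sum_ite_eq', if_pos (by simp; omega), if_pos (by simp; omega),
    map_smul, map_sum]
  module

/-- `H_{-n}` is the adjoint of `H_n` for odd `n`. -/
theorem fockInner_current_left {n : ℤ} (hn : Odd n) (v w : Fock) :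
    fockInner (current n v) w = fockInner v (current (-n) w) := by
  have hn0 : n ≠ 0 := by rintro rfl; simp at hn
  obtain ⟨A, h1, h2⟩ := ((eventually_current_eq_sum hn0 v).and
    (eventually_current_eq_sum (neg_ne_zero.2 hn0) w)).exists
  rw [h1, h2, map_smul, map_smul, map_sum, LinearMap.smul_apply, LinearMap.sum_apply, map_sum]
  congr 1
  refine Finset.sum_bij' (fun a _ => -a) (fun a _ => -a) ?_ ?_ ?_ ?_ ?_
  · intro a ha; simp only [Finset.mem_Icc] at ha ⊢; omega
  · intro a ha; simp only [Finset.mem_Icc] at ha ⊢; omega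
  · simp
  · simp
  · intro a _
    rw [map_smul, map_smul, LinearMap.smul_apply, fockInner_fermion_left, fockInner_fermion_left,
      fermion_swap (a := -a) (by omega), map_neg, show - -a - -n = -(-a - n) by ring]
    simp only [smul_eq_mul]
    have h3 : (-1 : ℝ) ^ (a + 1) = -(-1 : ℝ) ^ a := by rw [zpow_add₀ (by norm_num)]; simp
    have h4 : (-1 : ℝ) ^ (-a + 1) = -(-1 : ℝ) ^ a := by
      rw [zpow_add₀ (by norm_num), negOnePow_neg]; simp
    have h5 : (-1 : ℝ) ^ (-a - n) = -(-1 : ℝ) ^ a := by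
      rw [zpow_sub₀ (by norm_num), hn.neg_one_zpow, negOnePow_neg, div_neg, div_one]
    rw [h3, h4, h5]
    have := negOnePow_mul_self a
    linear_combination ((-1 : ℝ) ^ a * fockInner v (fermion (-(-a - n)) (fermion (-a) w))) * this

lemma current_vacuum {n : ℤ} (hn : 0 < n) : current n vacuum = 0 := by
  obtain ⟨A, h⟩ := (eventually_current_eq_sum hn.ne' vacuum).exists
  rw [h, Finset.sum_eq_zero, smul_zero]
  intro a _
  rcases lt_or_ge a 0 with ha | ha
  · rw [fermion_swap (by omega), fermion_vacuum_of_neg ha]; simp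
  · rw [fermion_vacuum_of_neg (by omega : -a - n < 0)]; simp

/-- The two-point function `⟨0|φ_i φ_{-i}|0⟩`, up to its sign, as a function of `-i`. -/
def vacuumOccupation (j : ℤ) : ℝ := if 0 < j then 1 else if j = 0 then 1 / 2 else 0

lemma vacuumOccupation_add_one (j : ℤ) : vacuumOccupation (j + 1) - vacuumOccupation j
    = (if j = 0 then 1 / 2 else 0) + (if j = -1 then 1 / 2 else 0) := by
  rcases lt_trichotomy j 0 with h | h | h
  · by_cases h' : j = -1
    · subst h'; norm_num [vacuumOccupation]
    · simp [vacuumOccupation, h.not_gt, h.ne, h', show ¬ (0 < j + 1) by omega,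
        show ¬ (j + 1 = 0) by omega]
  · subst h; norm_num [vacuumOccupation]
  · simp [vacuumOccupation, h, h.ne', show (0 < j + 1) by omega, show ¬ (j = -1) by omega]

lemma vacuumFunctional_vacuum : vacuumFunctional vacuum = 1 := by
  simp [vacuumFunctional, vacuum, ket]

lemma vacuumFunctional_fermion {i : ℤ} (hi : 0 < i) (v : Fock) :
    vacuumFunctional (fermion i v) = 0 := by
  rw [← fockInner_vacuum, fockInner_symm, fockInner_fermion_left, fermion_vacuum_of_neg (by omega)]
  simp

/-- The vacuum two-point function of the neutral fermions. -/
lemma vacuumFunctional_fermion_fermion (i j : ℤ) :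
    vacuumFunctional (fermion i (fermion j vacuum))
      = if i + j = 0 then (-1 : ℝ) ^ i * vacuumOccupation j else 0 := by
  have hc := congrArg vacuumFunctional (fermion_anticomm i j vacuum)
  rw [map_add, map_smul, vacuumFunctional_vacuum, smul_eq_mul, mul_one] at hc
  rcases lt_trichotomy j 0 with hj | hj | hj
  · rw [fermion_vacuum_of_neg hj]
    simp [vacuumOccupation, hj.not_gt, hj.ne]
  · subst hj
    rcases lt_trichotomy i 0 with hi | hi | hi
    · rw [fermion_vacuum_of_neg hi, map_zero, map_zero, add_zero] at hc
      rw [hc]; simp [hi.ne]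
    · subst hi
      simp only [add_zero, if_true, zpow_zero] at hc
      simp only [vacuumOccupation, add_zero, if_true, zpow_zero, lt_irrefl, if_false]
      linarith
    · rw [vacuumFunctional_fermion hi]; simp [hi.ne']
  · rw [vacuumFunctional_fermion hj, add_zero] at hc
    rw [hc]; simp [vacuumOccupation, hj]

/-- The vacuum two-point function of the currents, from which their commutator is found. -/
lemma vacuumFunctional_current_current {n m : ℕ} (hn : Odd n) (hm : Odd m) :
    vacuumFunctional (current n (current (-m) vacuum)) = if n = m then (n : ℝ) / 2 else 0 := by
  have hn' : Odd (n : ℤ) := by exact_mod_cast hn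
  have hm0 : -(m : ℤ) ≠ 0 := by have := hm.pos; omega
  have hnpos : (0 : ℤ) < n := by exact_mod_cast hn.pos
  obtain ⟨A, h, hA⟩ := ((eventually_current_eq_sum hm0 vacuum).and
    (eventually_ge_atTop (n : ℤ))).exists
  rw [h, map_smul, map_sum, map_smul, map_sum]
  have t1 : ∀ a : ℤ, vacuumFunctional (current n (((-1 : ℝ) ^ (a + 1)) •
      fermion a (fermion (-a - -m) vacuum))) =
      if n = m then vacuumOccupation (n - a) - vacuumOccupation (-a) else 0 := by
    intro a
    rw [map_smul, map_smul, current_fermion hn', current_fermion hn', current_vacuum hnpos,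
      map_zero, zero_add, map_add, vacuumFunctional_fermion_fermion,
      vacuumFunctional_fermion_fermion]
    by_cases hnm : n = m
    · subst hnm
      rw [if_pos (by ring), if_pos (by ring), if_pos rfl, zpow_sub₀ (by norm_num),
        zpow_add₀ (by norm_num), hn'.neg_one_zpow, show -a - -(n : ℤ) = n - a by ring,
        show (n : ℤ) - a - n = -a by ring]
      have := negOnePow_mul_self a
      simp only [smul_eq_mul, zpow_one]
      linear_combination (vacuumOccupation (n - a) - vacuumOccupation (-a)) * this
    · rw [if_neg (by omega), if_neg (by omega), if_neg hnm]; simp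
  rw [Finset.sum_congr rfl fun a _ => t1 a]
  by_cases hnm : n = m
  -- Each difference is a sum of `n` steps of `vacuumOccupation`, which increases by one in total.
  · have tele : ∀ a : ℤ, vacuumOccupation (n - a) - vacuumOccupation (-a) =
        ∑ i ∈ Finset.range n, ((if a = (i : ℤ) then (1 / 2 : ℝ) else 0)
          + (if a = (i : ℤ) + 1 then 1 / 2 else 0)) := by
      intro a
      have := Finset.sum_range_sub (fun i : ℕ => vacuumOccupation (i - a)) n
      simp only [Nat.cast_zero, zero_sub] at this
      rw [← this]
      refine Finset.sum_congr rfl fun i _ => ?_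
      rw [show ((i + 1 : ℕ) : ℤ) - a = (i - a) + 1 by push_cast; ring, vacuumOccupation_add_one]
      congr 1 <;> exact if_congr (by omega) rfl rfl
    simp only [if_pos hnm]
    rw [Finset.sum_congr rfl fun a _ => tele a, Finset.sum_comm, Finset.sum_congr rfl
      (g := fun _ => (1 : ℝ))]
    · simp; ring
    · intro i hi
      rw [Finset.mem_range] at hi
      rw [Finset.sum_add_distrib, Finset.sum_ite_eq', Finset.sum_ite_eq',
        if_pos (by simp; omega), if_pos (by simp; omega)]
      norm_num
  · simp [hnm]

/-! ### Parity -/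

/-- The parity operator `(-1)^F`, with `F` the number of fermions. -/
def parity : Module.End ℝ Fock :=
  Finsupp.linearCombination ℝ fun S => (-1 : ℝ) ^ S.card • ket S

lemma parity_ket (S : Finset ℕ) : parity (ket S) = (-1 : ℝ) ^ S.card • ket S := by
  simp [parity, ket, Finsupp.linearCombination_single]

lemma parity_apply (v : Fock) (S : Finset ℕ) : parity v S = (-1 : ℝ) ^ S.card * v S := by
  induction v using ket_induction with
  | h0 => simp
  | hadd v w hv hw => simp [hv, hw, mul_add]
  | hket c T =>
    rw [map_smul, parity_ket]
    by_cases h : T = S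
    · subst h; simp [ket, mul_comm]
    · simp [ket, h]

lemma parity_fermion (a : ℤ) (v : Fock) : parity (fermion a v) = -fermion a (parity v) := by
  induction v using ket_induction with
  | h0 => simp
  | hadd v w hv hw => simp only [map_add, hv, hw, neg_add]
  | hket c S =>
    have h : (-1 : ℝ) ^ (S ∆ {a.natAbs}).card = -(-1 : ℝ) ^ S.card := by
      by_cases hb : a.natAbs ∈ S
      · have : S ∆ {a.natAbs} = S.erase a.natAbs := by ext x; simp [Finset.mem_symmDiff]; grind
        rw [this, ← Finset.card_erase_add_one hb, pow_succ]; ring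
      · have : S ∆ {a.natAbs} = insert a.natAbs S := by ext x; simp [Finset.mem_symmDiff]; grind
        rw [this, Finset.card_insert_of_notMem hb, pow_succ]; ring
    simp only [map_smul, parity_ket, fermion_ket, h]
    module

lemma parity_current {n : ℤ} (hn : n ≠ 0) (v : Fock) :
    parity (current n v) = current n (parity v) := by
  obtain ⟨A, h1, h2⟩ := ((eventually_current_eq_sum hn v).and
    (eventually_current_eq_sum hn (parity v))).exists
  rw [h1, h2, map_smul, map_sum]
  congr 1
  refine Finset.sum_congr rfl fun a _ => ?_
  rw [map_smul, parity_fermion, parity_fermion, map_neg, neg_neg]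

/-! ### The Heisenberg relation -/

/-- The adjoint `∑ t_n H_{-n}` of `H₊(t)`. -/
def raising (t : Miwa) : Module.End ℝ Fock := t.sum fun n c => c • current (-(n : ℕ) : ℤ)

lemma hPlus_apply (t : Miwa) (v : Fock) :
    hPlus t v = t.sum fun n c => c • current (n : ℕ) v := by
  simp [hPlus, Finsupp.sum, hamiltonian_eq_current, LinearMap.sum_apply]

lemma raising_apply (t : Miwa) (v : Fock) :
    raising t v = t.sum fun n c => c • current (-(n : ℕ) : ℤ) v := by
  simp [raising, Finsupp.sum, LinearMap.sum_apply]

lemma hPlus_fermion (t : Miwa) (b : ℤ) (v : Fock) :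
    hPlus t (fermion b v)
      = fermion b (hPlus t v) + t.sum fun n c => c • fermion (b - (n : ℕ)) v := by
  simp only [hPlus_apply, Finsupp.sum, map_sum, map_smul]
  rw [← Finset.sum_add_distrib]
  refine Finset.sum_congr rfl fun n _ => ?_
  rw [current_fermion (by exact_mod_cast n.2), smul_add]

lemma raising_fermion (t : Miwa) (b : ℤ) (v : Fock) :
    raising t (fermion b v)
      = fermion b (raising t v) + t.sum fun n c => c • fermion (b + (n : ℕ)) v := by
  simp only [raising_apply, Finsupp.sum, map_sum, map_smul]
  rw [← Finset.sum_add_distrib]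
  refine Finset.sum_congr rfl fun n _ => ?_
  rw [current_fermion (Odd.neg (by exact_mod_cast n.2)), smul_add, sub_neg_eq_add]

lemma fockInner_raising_left (t : Miwa) (v w : Fock) :
    fockInner (raising t v) w = fockInner v (hPlus t w) := by
  simp only [hPlus_apply, raising_apply, Finsupp.sum, map_sum, map_smul, LinearMap.sum_apply,
    LinearMap.smul_apply]
  refine Finset.sum_congr rfl fun n _ => ?_
  rw [fockInner_current_left (Odd.neg (by exact_mod_cast n.2)), neg_neg]

lemma hPlus_vacuum (t : Miwa) : hPlus t vacuum = 0 := by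
  rw [hPlus_apply]
  refine Finset.sum_eq_zero fun n _ => ?_
  have : (0 : ℤ) < (n : ℕ) := by exact_mod_cast n.2.pos
  simp only [current_vacuum this, smul_zero]

lemma parity_hPlus (t : Miwa) (v : Fock) : parity (hPlus t v) = hPlus t (parity v) := by
  simp only [hPlus_apply, Finsupp.sum, map_sum, map_smul]
  refine Finset.sum_congr rfl fun n _ => ?_
  rw [parity_current]
  have := n.2.pos
  omega

lemma parity_raising (t : Miwa) (v : Fock) : parity (raising t v) = raising t (parity v) := by
  simp only [raising_apply, Finsupp.sum, map_sum, map_smul]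
  refine Finset.sum_congr rfl fun n _ => ?_
  rw [parity_current]
  have := n.2.pos
  omega

lemma parity_vacuum : parity vacuum = vacuum := by
  rw [vacuum, parity_ket]; simp

/-- The central charge `∑ n t_n² / 2` of the Heisenberg relation. -/
def heisenbergConst (t : Miwa) : ℝ := t.sum fun n c => (n : ℝ) * c ^ 2 / 2

lemma heisenbergConst_nonneg (t : Miwa) : 0 ≤ heisenbergConst t :=
  Finset.sum_nonneg fun n _ => by positivity

lemma vacuumFunctional_hPlus_raising (t : Miwa) :
    vacuumFunctional (hPlus t (raising t vacuum)) = heisenbergConst t := by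
  simp only [hPlus_apply, raising_apply, Finsupp.sum, map_sum, map_smul, heisenbergConst]
  refine Finset.sum_congr rfl fun n hn => ?_
  rw [smul_eq_mul, Finset.sum_eq_single n]
  · rw [vacuumFunctional_current_current n.2 n.2, if_pos rfl, smul_eq_mul]; ring
  · intro m _ hm
    rw [vacuumFunctional_current_current m.2 n.2, if_neg, smul_zero]
    exact fun h => hm (Subtype.ext h)
  · exact fun h => absurd hn h

/-- An even vector annihilated by all `φ_b` with `b < 0` is a multiple of the vacuum. -/
lemma eq_smul_vacuum {y : Fock} (h : ∀ b < 0, fermion b y = 0) (hp : parity y = y) :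
    y = vacuumFunctional y • vacuum := by
  ext S
  by_cases hS : ∃ a ∈ S, 0 < a
  · obtain ⟨a, ha, hpos⟩ := hS
    have hSe : S ≠ ∅ := Finset.ne_empty_of_mem ha
    have h0 : y S = 0 := by
      refine eq_zero_of_fockInner_ket ?_
      have h1 : S ∆ {a} ∆ {a} = S := by simp
      have h2 : a ∉ S ∆ {a} := by simp [Finset.mem_symmDiff, ha]
      have h3 := fermion_ket a (S ∆ {a})
      rw [Int.natAbs_natCast, h1] at h3
      have h4 : flipCoeff a (S ∆ {a}) ≠ 0 := by
        simp [flipCoeff, occupationFactor, h2, passSign]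
      have h5 : fockInner (flipCoeff a (S ∆ {a}) • ket S) y = 0 := by
        rw [← h3, fockInner_fermion_left, h _ (by omega)]; simp
      rw [map_smul, LinearMap.smul_apply, smul_eq_mul] at h5
      exact (mul_eq_zero.1 h5).resolve_left h4
    rw [h0]
    simp [vacuum, ket, hSe.symm]
  · push Not at hS
    by_cases hSe : S = ∅
    · subst hSe; simp [vacuum, ket, vacuumFunctional]
    · have : S = {0} := by
        rcases Finset.subset_singleton_iff.1 (show S ⊆ {0} from fun x hx => by
          have := hS x hx; simp; omega) with h | h
        · exact absurd h hSe
        · exact h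
      subst this
      have h1 := congrArg (fun v : Fock => v {0}) hp
      simp only [parity_apply] at h1
      have h2 : y {0} = 0 := by
        simp at h1; linarith
      rw [h2]
      simp [vacuum, ket]

/-- The Heisenberg relation between `H₊(t)` and its adjoint. The commutator commutes with all
fermions, so that it is determined by its value on the vacuum. -/
theorem hPlus_raising (t : Miwa) (v : Fock) :
    hPlus t (raising t v) = raising t (hPlus t v) + heisenbergConst t • v := by
  have hcomm : ∀ (b : ℤ) (w : Fock), hPlus t (raising t (fermion b w))
      - raising t (hPlus t (fermion b w))
      = fermion b (hPlus t (raising t w) - raising t (hPlus t w)) := by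
    intro b w
    rw [raising_fermion, hPlus_fermion, map_add, map_add, hPlus_fermion, raising_fermion, map_sub]
    have : hPlus t (t.sum fun n c => c • fermion (b + (n : ℕ)) w)
        - raising t (t.sum fun n c => c • fermion (b - (n : ℕ)) w)
        = t.sum (fun n c => c • fermion (b + (n : ℕ)) (hPlus t w))
          - t.sum (fun n c => c • fermion (b - (n : ℕ)) (raising t w)) := by
      simp only [Finsupp.sum, map_sum, map_smul, hPlus_fermion, raising_fermion, smul_add,
        Finset.sum_add_distrib, Finset.smul_sum]
      rw [add_sub_add_comm, add_eq_left, sub_eq_zero, Finset.sum_comm]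
      refine Finset.sum_congr rfl fun n _ => Finset.sum_congr rfl fun m _ => ?_
      rw [smul_comm, show b + (m : ℕ) - ((n : ℕ) : ℤ) = b - (n : ℕ) + ((m : ℕ) : ℤ) by ring]
    linear_combination (norm := module) this
  have hvac : hPlus t (raising t vacuum) - raising t (hPlus t vacuum)
      = heisenbergConst t • vacuum := by
    rw [← vacuumFunctional_hPlus_raising, hPlus_vacuum, map_zero, sub_zero]
    refine eq_smul_vacuum (fun b hb => ?_) ?_
    · have := hcomm b vacuum
      rw [fermion_vacuum_of_neg hb, hPlus_vacuum] at this
      simpa using this.symm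
    · rw [parity_hPlus, parity_raising, parity_vacuum]
  have key : hPlus t * raising t - raising t * hPlus t
      = heisenbergConst t • (1 : Module.End ℝ Fock) := by
    refine linearMap_ext_ket fun S => ?_
    simp only [LinearMap.sub_apply, Module.End.mul_apply, LinearMap.smul_apply, Module.End.one_apply]
    induction S using Finset.induction_on_max with
    | empty => exact hvac
    | insert a S h ih => rw [ket_insert_of_max h, hcomm, ih, map_smul]
  have := congrArg (fun f : Module.End ℝ Fock => f v) key
  simp only [LinearMap.sub_apply, Module.End.mul_apply, LinearMap.smul_apply,
    Module.End.one_apply] at this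
  rw [← this]; abel

lemma hPlus_raising_pow (t : Miwa) (k : ℕ) :
    hPlus t ((raising t ^ (k + 1)) vacuum)
      = (((k : ℝ) + 1) * heisenbergConst t) • (raising t ^ k) vacuum := by
  induction k with
  | zero => simp [hPlus_raising, hPlus_vacuum]
  | succ k ih =>
    rw [pow_succ', Module.End.mul_apply, hPlus_raising, ih, map_smul, ← Module.End.mul_apply,
      ← pow_succ', ← add_smul]
    congr 1
    push_cast; ring

lemma fockInner_raising_pow (t : Miwa) (j k : ℕ) :
    fockInner ((raising t ^ j) vacuum) ((raising t ^ k) vacuum)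
      = if j = k then (k ! : ℝ) * heisenbergConst t ^ k else 0 := by
  induction j generalizing k with
  | zero =>
    cases k with
    | zero => simp [fockInner_vacuum, vacuumFunctional_vacuum]
    | succ k =>
      rw [pow_succ', Module.End.mul_apply, fockInner_symm, fockInner_raising_left]
      simp [hPlus_vacuum]
  | succ j ih =>
    cases k with
    | zero =>
      rw [pow_succ', Module.End.mul_apply, fockInner_raising_left]
      simp [hPlus_vacuum]
    | succ k =>
      rw [pow_succ' _ j, Module.End.mul_apply, fockInner_raising_left, hPlus_raising_pow, map_smul,
        ih]
      by_cases h : j = k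
      · subst h; simp [Nat.factorial_succ, pow_succ]; ring
      · simp [h]

lemma fockInner_raising_pow_left (t : Miwa) (k : ℕ) (v w : Fock) :
    fockInner ((raising t ^ k) v) w = fockInner v ((hPlus t ^ k) w) := by
  induction k generalizing w with
  | zero => simp
  | succ k ih =>
    rw [pow_succ', Module.End.mul_apply, fockInner_raising_left, ih, pow_succ, Module.End.mul_apply]

/-! ### The coherent state and the fermion field -/

lemma norm_toL2_sq (v : Fock) : ‖toL2 v‖ ^ 2 = fockInner v v := by
  rw [fockInner_apply, real_inner_self_eq_norm_sq]

/-- The adjoint `(-1)^a φ_{-a}` of the neutral fermion `φ_a`. -/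
def fermionAdj (a : ℤ) : Module.End ℝ Fock := (-1 : ℝ) ^ a • fermion (-a)

lemma fockInner_fermionAdj_left (a : ℤ) (v w : Fock) :
    fockInner (fermionAdj a v) w = fockInner v (fermion a w) := by
  rw [fermionAdj, LinearMap.smul_apply, map_smul, LinearMap.smul_apply, fockInner_fermion_left,
    negOnePow_neg, smul_eq_mul, ← mul_assoc, negOnePow_mul_self, neg_neg, one_mul]

lemma fockInner_fermionAdj_add (a b : ℤ) (v w : Fock) :
    fockInner (fermionAdj a v) (fermionAdj b w)
      + (-1 : ℝ) ^ (a + b) * fockInner (fermionAdj (-b) v) (fermionAdj (-a) w)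
      = if a = b then fockInner v w else 0 := by
  have h := congrArg (fun x => (-1 : ℝ) ^ b * fockInner v x) (fermion_anticomm a (-b) w)
  simp only [map_add, map_smul, smul_eq_mul] at h
  rw [fockInner_fermionAdj_left, fockInner_fermionAdj_left]
  simp only [fermionAdj, LinearMap.smul_apply, map_smul, smul_eq_mul, neg_neg, negOnePow_neg]
  rw [zpow_add₀ (by norm_num)]
  have e := negOnePow_mul_self a
  by_cases hab : a = b
  · subst hab
    rw [if_pos rfl]
    rw [if_pos (by ring)] at h
    linear_combination h + ((-1 : ℝ) ^ a * fockInner v (fermion (-a) (fermion a w))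
      + fockInner v w) * e
  · rw [if_neg hab]
    rw [if_neg (by omega)] at h
    linear_combination h + ((-1 : ℝ) ^ b * fockInner v (fermion (-b) (fermion a w))) * e

/-- By the anticommutation relations `‖φ_a† v‖² + ‖φ_a v‖² = ‖v‖²`. -/
lemma norm_toL2_fermionAdj_le (a : ℤ) (v : Fock) : ‖toL2 (fermionAdj a v)‖ ≤ ‖toL2 v‖ := by
  have h := fockInner_fermionAdj_add a a v v
  rw [if_pos rfl, ← two_mul, zpow_mul, ← norm_toL2_sq, ← norm_toL2_sq, ← norm_toL2_sq] at h
  norm_num at h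
  exact (sq_le_sq₀ (norm_nonneg _) (norm_nonneg _)).1
    (by have := sq_nonneg ‖toL2 (fermionAdj (-a) v)‖; linarith)

lemma summable_sqrt_pow_div_factorial {x : ℝ} (hx : 0 ≤ x) :
    Summable fun k : ℕ => √(x ^ k / k !) := by
  -- The inequality `√(ab) ≤ a + b` with `a = (4x)^k / k!` and `b = 4^{-k}`.
  refine Summable.of_nonneg_of_le (fun _ => Real.sqrt_nonneg _) (fun k => ?_)
    ((Real.summable_pow_div_factorial (4 * x)).add
      (summable_geometric_of_lt_one (r := (1 / 4 : ℝ)) (by norm_num) (by norm_num)))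
  have h1 : x ^ k / k ! = ((4 * x) ^ k / k !) * (1 / 4) ^ k := by
    rw [div_mul_eq_mul_div, ← mul_pow]; congr 2; ring
  have h2 : 0 ≤ (4 * x) ^ k / k ! := by positivity
  have h3 : (0 : ℝ) ≤ (1 / 4) ^ k := by positivity
  rw [h1]
  refine Real.sqrt_le_iff.2 ⟨by positivity, ?_⟩
  nlinarith [mul_nonneg h2 h3, sq_nonneg ((4 * x) ^ k / k !), sq_nonneg ((1 / 4 : ℝ) ^ k)]

/-- The term of order `k` of the coherent state `e^{H₋(t)} |0⟩`, where `H₋(t)` is the adjoint of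
`H₊(t)`. -/
def coherentTerm (t : Miwa) (k : ℕ) : Fock := ((k ! : ℝ))⁻¹ • (raising t ^ k) vacuum

lemma fockInner_coherentTerm (t : Miwa) (j k : ℕ) :
    fockInner (coherentTerm t j) (coherentTerm t k)
      = if j = k then heisenbergConst t ^ k / k ! else 0 := by
  simp only [coherentTerm, map_smul, LinearMap.smul_apply, fockInner_raising_pow, smul_eq_mul]
  split_ifs with h
  · subst h
    have : (j ! : ℝ) ≠ 0 := by positivity
    field_simp
  · simp

lemma summable_norm_coherentTerm (t : Miwa) : Summable fun k => ‖toL2 (coherentTerm t k)‖ := by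
  convert summable_sqrt_pow_div_factorial (heisenbergConst_nonneg t) using 2 with k
  have h := norm_toL2_sq (coherentTerm t k)
  rw [fockInner_coherentTerm, if_pos rfl] at h
  rw [← h, Real.sqrt_sq (norm_nonneg _)]

/-- The coherent state `e^{H₋(t)} |0⟩` in the completed Fock space. -/
def coherentState (t : Miwa) : FockL2 := ∑' k, toL2 (coherentTerm t k)

lemma hasSum_coherentState (t : Miwa) :
    HasSum (fun k => toL2 (coherentTerm t k)) (coherentState t) :=
  (summable_norm_coherentTerm t).of_norm.hasSum

/-- The coherent state represents the functional `v ↦ ⟨0|e^{H₊(t)}|v⟩`. -/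
lemma inner_coherentState (t : Miwa) (v : Fock) :
    inner ℝ (coherentState t) (toL2 v) = expVacuum t v := by
  have h := (hasSum_coherentState t).mapL (innerSL ℝ (toL2 v))
  rw [expVacuum, real_inner_comm]
  refine h.tsum_eq.symm.trans (tsum_congr fun k => ?_)
  rw [innerSL_apply_apply, real_inner_comm, ← fockInner_apply, coherentTerm, map_smul,
    LinearMap.smul_apply, fockInner_raising_pow_left, fockInner_vacuum, smul_eq_mul]

/-- The sum of the first `N` terms of the coherent state. -/
def coherentPartial (t : Miwa) (N : ℕ) : Fock := ∑ k ∈ Finset.range N, coherentTerm t k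

lemma tendsto_coherentPartial (t : Miwa) :
    Tendsto (fun N => toL2 (coherentPartial t N)) atTop (𝓝 (coherentState t)) := by
  simp only [coherentPartial, map_sum]
  exact (hasSum_coherentState t).tendsto_sum_nat

lemma tendsto_fockInner_coherentPartial (t : Miwa) :
    Tendsto (fun N => fockInner (coherentPartial t N) (coherentPartial t N)) atTop
      (𝓝 (Real.exp (heisenbergConst t))) := by
  have h : HasSum (fun k : ℕ => heisenbergConst t ^ k / k !) (Real.exp (heisenbergConst t)) := by
    rw [Real.exp_eq_exp_ℝ]
    exact NormedSpace.expSeries_div_hasSum_exp (heisenbergConst t)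
  refine h.tendsto_sum_nat.congr fun N => ?_
  simp only [coherentPartial, map_sum, LinearMap.sum_apply, fockInner_coherentTerm]
  refine Finset.sum_congr rfl fun k hk => ?_
  rw [Finset.sum_ite_eq', if_pos hk]

lemma norm_coherentState_sq (t : Miwa) :
    ‖coherentState t‖ ^ 2 = Real.exp (heisenbergConst t) := by
  refine tendsto_nhds_unique ((tendsto_coherentPartial t).norm.pow 2) ?_
  simp only [norm_toL2_sq]
  exact tendsto_fockInner_coherentPartial t

/-- The bounded sequence `b ↦ φ_b† v` in the completed Fock space. -/
def fermionField : Fock →ₗ[ℝ] (ℤ →ᵇ FockL2) where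
  toFun v := BoundedContinuousFunction.ofNormedAddCommGroupDiscrete
    (fun b => toL2 (fermionAdj b v)) ‖toL2 v‖ fun b => norm_toL2_fermionAdj_le b v
  map_add' v w := by ext1 b; simp
  map_smul' c v := by ext1 b; simp

lemma norm_fermionField_le (v : Fock) : ‖fermionField v‖ ≤ ‖toL2 v‖ :=
  (BoundedContinuousFunction.norm_le (norm_nonneg _)).2 fun b => norm_toL2_fermionAdj_le b v

lemma summable_norm_fermionField (t : Miwa) :
    Summable fun k => ‖fermionField (coherentTerm t k)‖ :=
  (summable_norm_coherentTerm t).of_nonneg_of_le (fun _ => norm_nonneg _)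
    fun _ => norm_fermionField_le _

/-- The sequence of the vectors `φ_b† e^{H₋(t)} |0⟩`. -/
def fieldState (t : Miwa) : ℤ →ᵇ FockL2 := ∑' k, fermionField (coherentTerm t k)

lemma hasSum_fieldState (t : Miwa) :
    HasSum (fun k => fermionField (coherentTerm t k)) (fieldState t) :=
  (summable_norm_fermionField t).of_norm.hasSum

lemma hasSum_fieldState_apply (t : Miwa) (b : ℤ) :
    HasSum (fun k => toL2 (fermionAdj b (coherentTerm t k))) (fieldState t b) :=
  (hasSum_fieldState t).mapL (BoundedContinuousFunction.evalCLM ℝ b)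

lemma inner_fieldState (t : Miwa) (b : ℤ) (v : Fock) :
    inner ℝ (fieldState t b) (toL2 v) = expVacuum t (fermion b v) := by
  have h := (hasSum_fieldState_apply t b).mapL (innerSL ℝ (toL2 v))
  rw [expVacuum, real_inner_comm]
  refine h.tsum_eq.symm.trans (tsum_congr fun k => ?_)
  rw [innerSL_apply_apply, real_inner_comm, ← fockInner_apply, fockInner_fermionAdj_left,
    coherentTerm, map_smul, LinearMap.smul_apply, fockInner_raising_pow_left, fockInner_vacuum,
    smul_eq_mul]

lemma tendsto_fermionAdj_coherentPartial (t : Miwa) (b : ℤ) :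
    Tendsto (fun N => toL2 (fermionAdj b (coherentPartial t N))) atTop (𝓝 (fieldState t b)) := by
  simp only [coherentPartial, map_sum]
  exact (hasSum_fieldState_apply t b).tendsto_sum_nat

/-- The anticommutation relations between the vectors `φ_b† e^{H₋(t)} |0⟩`. -/
theorem inner_fieldState_add (t : Miwa) (a b : ℤ) :
    inner ℝ (fieldState t a) (fieldState t b)
      + (-1 : ℝ) ^ (a + b) * inner ℝ (fieldState t (-b)) (fieldState t (-a))
      = if a = b then Real.exp (heisenbergConst t) else 0 := by
  have h1 := ((tendsto_fermionAdj_coherentPartial t a).inner (𝕜 := ℝ)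
    (tendsto_fermionAdj_coherentPartial t b)).add
    (((tendsto_fermionAdj_coherentPartial t (-b)).inner (𝕜 := ℝ)
    (tendsto_fermionAdj_coherentPartial t (-a))).const_mul ((-1 : ℝ) ^ (a + b)))
  refine tendsto_nhds_unique h1 ?_
  simp only [← fockInner_apply, fockInner_fermionAdj_add]
  split_ifs
  · exact tendsto_fockInner_coherentPartial t
  · exact tendsto_const_nhds

/-! ### Coordinates -/

/-- Parseval's identity for the orthogonal family of kets. -/
lemma hasSum_norm_sq (x : FockL2) :
    HasSum (fun S => (inner ℝ x (toL2 (ket S))) ^ 2 / ketNormSq S) (‖x‖ ^ 2) := by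
  have h := lp.hasSum_inner (𝕜 := ℝ) x x
  rw [real_inner_self_eq_norm_sq] at h
  have e : (fun S => (inner ℝ x (toL2 (ket S))) ^ 2 / ketNormSq S)
      = fun S => inner ℝ (x S) (x S) := by
    funext S
    rw [inner_toL2_ket_right, mul_pow, Real.sq_sqrt (ketNormSq_pos S).le,
      mul_div_cancel_left₀ _ (ketNormSq_pos S).ne']
    simp [sq]
  rw [e]; exact h

/-- The weight of the basis vector `ket S` in the coherent state. -/
def ketWeight (t : Miwa) (S : Finset ℕ) : ℝ := expVacuum t (ket S) ^ 2 / ketNormSq S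

lemma ketWeight_nonneg (t : Miwa) (S : Finset ℕ) : 0 ≤ ketWeight t S :=
  div_nonneg (sq_nonneg _) (ketNormSq_pos S).le

lemma hasSum_ketWeight (t : Miwa) :
    HasSum (ketWeight t) (Real.exp (heisenbergConst t)) := by
  rw [← norm_coherentState_sq]
  convert hasSum_norm_sq (coherentState t) using 2 with S
  rw [inner_coherentState, ketWeight]

lemma ketWeight_of_odd (t : Miwa) {S : Finset ℕ} (hS : Odd S.card) : ketWeight t S = 0 := by
  have h : ∀ k, vacuumFunctional ((hPlus t ^ k) (ket S)) = 0 := by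
    intro k
    have h1 : parity ((hPlus t ^ k) (ket S)) = -(hPlus t ^ k) (ket S) := by
      have : ∀ v, parity ((hPlus t ^ k) v) = (hPlus t ^ k) (parity v) := by
        intro v
        induction k with
        | zero => simp
        | succ k ih =>
          rw [pow_succ', Module.End.mul_apply, parity_hPlus, ih, Module.End.mul_apply]
      rw [this, parity_ket, hS.neg_one_pow]; simp
    have h2 := congrArg (fun v : Fock => v ∅) h1
    simp only [parity_apply, Finsupp.neg_apply, Finset.card_empty, pow_zero, one_mul] at h2
    simp only [vacuumFunctional, Finsupp.lapply_apply]
    linarith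
  simp [ketWeight, expVacuum, h]

/-- The squared length of `φ_a† e^{H₋(t)} |0⟩` is the total weight of the states with a particle
at `a`. -/
lemma hasSum_ketWeight_mem (t : Miwa) {a : ℕ} (ha : a ≠ 0) :
    HasSum (fun S : Finset ℕ => if a ∈ S then ketWeight t S else 0) (‖fieldState t a‖ ^ 2) := by
  have h := hasSum_norm_sq (fieldState t a)
  -- The component of `φ_a† u` at `S` is that of `u` at `S ∆ {a}` if `a ∉ S`, and zero otherwise.
  have hinv : Function.Involutive (fun S : Finset ℕ => S ∆ {a}) := fun S => by simp
  rw [← hinv.toPerm.hasSum_iff]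
  convert h using 2 with S
  have hz : 0 ∈ S ∆ {a} ↔ 0 ∈ S := by simp [Finset.mem_symmDiff, Ne.symm ha]
  simp only [Function.comp, Function.Involutive.coe_toPerm]
  rw [inner_fieldState, fermion_ket]
  have hlin : ∀ (c : ℝ) v, expVacuum t (c • v) = c * expVacuum t v := by
    intro c v
    rw [← inner_coherentState, ← inner_coherentState, map_smul, inner_smul_right]
  rw [hlin, Int.natAbs_natCast, ketWeight, ketNormSq, ketNormSq]
  simp only [hz]
  by_cases hS : a ∈ S
  · have : a ∉ S ∆ {a} := by simp [Finset.mem_symmDiff, hS]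
    simp [this, flipCoeff, occupationFactor, hS, Nat.pos_of_ne_zero ha]
  · have : a ∈ S ∆ {a} := by simp [Finset.mem_symmDiff, hS]
    have e := passSign_mul_self a S
    simp only [this, if_true, flipCoeff, occupationFactor, Int.natAbs_natCast, hS, if_false,
      Nat.cast_nonneg, mul_one, mul_pow, sq (passSign a S), e, one_mul]

/-! ### Exponentials of Laurent polynomials in Banach algebras -/

/-- The coefficients of the `m`-th power of the Laurent polynomial `q`. -/
def powCoeff (q : ℤ →₀ ℝ) : ℕ → ℤ → ℝ
  | 0 => Pi.single 0 1
  | m + 1 => fun j => q.sum fun k c => c * powCoeff q m (j - k)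

lemma powCoeff_succ (q : ℤ →₀ ℝ) (m : ℕ) (j : ℤ) :
    powCoeff q (m + 1) j = ∑ k ∈ q.support, q k * powCoeff q m (j - k) := rfl

/-- The coefficients of the exponential of the Laurent polynomial `q`. -/
def expCoeff (q : ℤ →₀ ℝ) (j : ℤ) : ℝ := ∑' m : ℕ, powCoeff q m j / m !

lemma summable_powCoeff (q : ℤ →₀ ℝ) (m : ℕ) :
    Summable (fun j => |powCoeff q m j|) ∧
      ∑' j, |powCoeff q m j| ≤ (q.sum fun _ c => |c|) ^ m := by
  induction m with
  | zero =>
    have h : HasSum (fun j => |powCoeff q 0 j|) 1 := by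
      convert hasSum_single (0 : ℤ) _ using 1
      · simp [powCoeff]
      · intro j hj; simp [powCoeff, hj]
    exact ⟨h.summable, by rw [h.tsum_eq, pow_zero]⟩
  | succ m ih =>
    have hs : HasSum (fun j => ∑ k ∈ q.support, |q k| * |powCoeff q m (j - k)|)
        (∑ k ∈ q.support, |q k| * ∑' j, |powCoeff q m j|) :=
      hasSum_sum fun k _ => ((Equiv.subRight k).hasSum_iff.2 ih.1.hasSum).mul_left |q k|
    have hle : ∀ j, |powCoeff q (m + 1) j| ≤ ∑ k ∈ q.support, |q k| * |powCoeff q m (j - k)| := by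
      intro j
      rw [powCoeff_succ]
      refine (Finset.abs_sum_le_sum_abs _ _).trans (Finset.sum_le_sum fun k _ => ?_)
      rw [abs_mul]
    have h1 := hs.summable.of_nonneg_of_le (fun _ => abs_nonneg _) hle
    refine ⟨h1, (h1.tsum_le_tsum hle hs.summable).trans ?_⟩
    rw [hs.tsum_eq, ← Finset.sum_mul, pow_succ']
    exact mul_le_mul_of_nonneg_left ih.2 (Finset.sum_nonneg fun _ _ => abs_nonneg _)

lemma summable_powCoeff_div_factorial (q : ℤ →₀ ℝ) :
    Summable fun p : ℕ × ℤ => |powCoeff q p.1 p.2 / p.1 !| := by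
  refine (summable_prod_of_nonneg fun _ => abs_nonneg _).2 ⟨fun m => ?_, ?_⟩
  · simp only [abs_div]
    exact (summable_powCoeff q m).1.div_const _
  · refine (Real.summable_pow_div_factorial (q.sum fun _ c => |c|)).of_nonneg_of_le
      (fun m => tsum_nonneg fun _ => abs_nonneg _) fun m => ?_
    simp only [abs_div, Nat.abs_cast]
    rw [tsum_div_const]
    gcongr
    exact (summable_powCoeff q m).2

lemma summable_expCoeff (q : ℤ →₀ ℝ) : Summable fun j => |expCoeff q j| := by
  have h := ((Equiv.prodComm ℤ ℕ).summable_iff.2 (summable_powCoeff_div_factorial q))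
  refine h.prod.of_nonneg_of_le (fun _ => abs_nonneg _) fun j => ?_
  rw [expCoeff]
  have := norm_tsum_le_tsum_norm (f := fun m : ℕ => powCoeff q m j / m !) (h.prod_factor j)
  exact this

section Banach

variable {𝒜 : Type*} [NormedRing 𝒜] [NormedAlgebra ℝ 𝒜]

lemma hasSum_powCoeff (q : ℤ →₀ ℝ) {s : ℤ → 𝒜} (s0 : s 0 = 1) (sadd : ∀ k l, s (k + l) = s k * s l)
    (m : ℕ) : HasSum (fun j => powCoeff q m j • s j) ((Finsupp.linearCombination ℝ s q) ^ m) := by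
  induction m with
  | zero =>
    convert hasSum_single (0 : ℤ) _ using 1
    · simp [powCoeff, s0]
    · intro j hj; simp [powCoeff, hj]
  | succ m ih =>
    have h : HasSum (fun j => ∑ k ∈ q.support, q k • (powCoeff q m (j - k) • s j))
        (∑ k ∈ q.support, q k • (s k * (Finsupp.linearCombination ℝ s q) ^ m)) := by
      refine hasSum_sum fun k _ => ?_
      have h1 := (Equiv.subRight k).hasSum_iff.2 (ih.mul_left (s k))
      refine HasSum.const_smul _ ?_
      have e : (fun j => powCoeff q m (j - k) • s j)
          = (fun i => s k * powCoeff q m i • s i) ∘ Equiv.subRight k := by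
        funext j
        change powCoeff q m (j - k) • s j = s k * (powCoeff q m (j - k) • s (j - k))
        rw [mul_smul_comm, ← sadd, add_sub_cancel]
      rw [e]
      exact h1
    convert h using 2 with j
    · rw [powCoeff_succ, Finset.sum_smul]
      exact Finset.sum_congr rfl fun k _ => by rw [mul_smul]
    · rw [pow_succ', Finsupp.linearCombination_apply, Finsupp.sum, Finset.sum_mul]
      exact Finset.sum_congr rfl fun k _ => by rw [smul_mul_assoc]

variable [CompleteSpace 𝒜]

/-- The exponential of a Laurent polynomial `q(s)`, evaluated at an invertible element of a Banach
algebra with bounded powers `s k`, is `∑ expCoeff q j • s j`, with coefficients that do not depend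
on the Banach algebra. -/
theorem hasSum_expCoeff (q : ℤ →₀ ℝ) {s : ℤ → 𝒜} (s0 : s 0 = 1)
    (sadd : ∀ k l, s (k + l) = s k * s l) (hs : ∀ k, ‖s k‖ ≤ 1) :
    HasSum (fun j => expCoeff q j • s j) (NormedSpace.exp (Finsupp.linearCombination ℝ s q)) := by
  set F : ℕ × ℤ → 𝒜 := fun p => (powCoeff q p.1 p.2 / p.1 !) • s p.2 with hF
  have hsum : Summable F := by
    refine Summable.of_norm_bounded (summable_powCoeff_div_factorial q) fun p => ?_
    rw [norm_smul, Real.norm_eq_abs]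
    exact mul_le_of_le_one_right (abs_nonneg _) (hs _)
  have h1 : HasSum F (NormedSpace.exp (Finsupp.linearCombination ℝ s q)) := by
    have e := NormedSpace.exp_series_hasSum_exp' (𝕂 := ℝ) (Finsupp.linearCombination ℝ s q)
    have e2 : HasSum (fun m : ℕ => (m ! : ℝ)⁻¹ • (Finsupp.linearCombination ℝ s q) ^ m)
        (∑' p, F p) := by
      refine hsum.hasSum.prod_fiberwise fun m => ?_
      convert (hasSum_powCoeff q s0 sadd m).const_smul (m ! : ℝ)⁻¹ using 2 with j
      rw [hF, smul_smul]; ring_nf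
    rw [e.unique e2]
    exact hsum.hasSum
  have h2 := (Equiv.prodComm ℤ ℕ).hasSum_iff.2 h1
  refine h2.prod_fiberwise fun j => ?_
  refine HasSum.smul_const (f := fun m : ℕ => powCoeff q m j / m !) ?_ (s j)
  have h3 := ((Equiv.prodComm ℤ ℕ).summable_iff.2 (summable_powCoeff_div_factorial q)).prod_factor j
  exact (Summable.of_norm (f := fun m : ℕ => powCoeff q m j / m !) h3).hasSum

end Banach

/-- The Laurent polynomial `∑ t_n z^n`. -/
def posSymbol (t : Miwa) : ℤ →₀ ℝ := t.mapDomain fun n : {n : ℕ // Odd n} => ((n : ℕ) : ℤ)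

/-- The Laurent polynomial `∑ t_n z^{-n}`. -/
def negSymbol (t : Miwa) : ℤ →₀ ℝ := t.mapDomain fun n : {n : ℕ // Odd n} => -((n : ℕ) : ℤ)

lemma linearCombination_posSymbol {M : Type*} [AddCommGroup M] [Module ℝ M] (s : ℤ → M)
    (t : Miwa) : Finsupp.linearCombination ℝ s (posSymbol t) = t.sum fun n c => c • s (n : ℕ) := by
  rw [posSymbol, Finsupp.linearCombination_mapDomain]; rfl

lemma linearCombination_negSymbol {M : Type*} [AddCommGroup M] [Module ℝ M] (s : ℤ → M)
    (t : Miwa) :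
    Finsupp.linearCombination ℝ s (negSymbol t) = t.sum fun n c => c • s (-(n : ℕ) : ℤ) := by
  rw [negSymbol, Finsupp.linearCombination_mapDomain]; rfl

/-- The Laurent polynomial `∑ t_n (z^n - z^{-n})`. -/
def oddSymbol (t : Miwa) : ℤ →₀ ℝ := posSymbol t - negSymbol t

lemma linearCombination_oddSymbol_neg {M : Type*} [AddCommGroup M] [Module ℝ M] (s : ℤ → M)
    (t : Miwa) : Finsupp.linearCombination ℝ (fun k => s (-k)) (oddSymbol t)
      = -Finsupp.linearCombination ℝ s (oddSymbol t) := by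
  rw [oddSymbol, map_sub, map_sub, linearCombination_posSymbol, linearCombination_negSymbol,
    linearCombination_posSymbol, linearCombination_negSymbol]
  simp

/-- The polynomial `oddSymbol t` changes its sign under `z ↦ -z`, as only odd powers occur. -/
lemma linearCombination_oddSymbol_alternate {M : Type*} [AddCommGroup M] [Module ℝ M] (s : ℤ → M)
    (t : Miwa) : Finsupp.linearCombination ℝ (fun k => (-1 : ℝ) ^ k • s k) (oddSymbol t)
      = -Finsupp.linearCombination ℝ s (oddSymbol t) := by
  rw [oddSymbol, map_sub, map_sub, linearCombination_posSymbol, linearCombination_negSymbol,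
    linearCombination_posSymbol, linearCombination_negSymbol]
  have h : ∀ n : {n : ℕ // Odd n}, (-1 : ℝ) ^ ((n : ℕ) : ℤ) = -1 := fun n => by
    rw [zpow_natCast, n.2.neg_one_pow]
  simp only [negOnePow_neg, h, neg_smul, one_smul, smul_neg, Finsupp.sum, Finset.sum_neg_distrib]
  abel

/-! ### The shift on sequences of states -/

section Shift

variable {E : Type*} [NormedAddCommGroup E] [NormedSpace ℝ E]

/-- The translation `(f_a) ↦ (f_{a-k})` of bounded sequences. -/
def shift (k : ℤ) : (ℤ →ᵇ E) →L[ℝ] (ℤ →ᵇ E) :=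
  LinearMap.mkContinuous
    { toFun := fun f => f.compContinuous ⟨fun a => a - k, continuous_of_discreteTopology⟩
      map_add' := fun _ _ => rfl
      map_smul' := fun _ _ => rfl } 1 fun f => by
      rw [one_mul]; exact f.norm_compContinuous_le _

lemma shift_apply (k : ℤ) (f : ℤ →ᵇ E) (a : ℤ) : shift k f a = f (a - k) := rfl

lemma shift_zero : shift (E := E) 0 = 1 := by
  ext f a; simp [shift_apply]

lemma shift_add (k l : ℤ) : shift (E := E) (k + l) = shift k * shift l := by
  ext f a
  change f (a - (k + l)) = f (a - k - l)
  rw [sub_sub]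

lemma norm_shift_le (k : ℤ) : ‖shift (E := E) k‖ ≤ 1 :=
  LinearMap.mkContinuous_norm_le _ zero_le_one _

lemma commute_linearCombination_shift (p q : ℤ →₀ ℝ) :
    Commute (Finsupp.linearCombination ℝ (shift (E := E)) p)
      (Finsupp.linearCombination ℝ shift q) := by
  rw [Finsupp.linearCombination_apply, Finsupp.linearCombination_apply]
  refine Commute.sum_left _ _ _ fun k _ => Commute.sum_right _ _ _ fun l _ => ?_
  refine Commute.smul_left (Commute.smul_right ?_ _) _
  rw [Commute, SemiconjBy, ← shift_add, ← shift_add, add_comm]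

/-- Sequences vanishing at positive indices are preserved by the exponential of an operator that
preserves them. -/
lemma exp_apply_eq_zero [CompleteSpace E] {T : (ℤ →ᵇ E) →L[ℝ] (ℤ →ᵇ E)}
    (hT : ∀ f : ℤ →ᵇ E, (∀ b > 0, f b = 0) → ∀ b > 0, T f b = 0) {f : ℤ →ᵇ E}
    (hf : ∀ b > 0, f b = 0) {b : ℤ} (hb : 0 < b) : NormedSpace.exp T f b = 0 := by
  have hpow : ∀ m : ℕ, ∀ b > 0, (T ^ m) f b = 0 := by
    intro m
    induction m with
    | zero => simpa using hf
    | succ m ih => intro b hb; rw [pow_succ']; exact hT _ ih b hb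
  have h := ((NormedSpace.exp_series_hasSum_exp' (𝕂 := ℝ) T).mapL
    (ContinuousLinearMap.apply ℝ (ℤ →ᵇ E) f)).mapL (BoundedContinuousFunction.evalCLM ℝ b)
  refine h.unique ?_
  convert hasSum_zero with m
  change (m ! : ℝ)⁻¹ • ((T ^ m) f) b = 0
  rw [hpow m b hb, smul_zero]

end Shift

/-! ### Conjugation of the fermion field by the raising operators -/

lemma raising_fermionAdj (t : Miwa) (b : ℤ) (v : Fock) :
    raising t (fermionAdj b v)
      = fermionAdj b (raising t v) - t.sum fun n c => c • fermionAdj (b - (n : ℕ)) v := by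
  simp only [fermionAdj, LinearMap.smul_apply, map_smul, raising_fermion, smul_add, sub_eq_add_neg,
    add_right_inj, Finsupp.sum, Finset.smul_sum]
  rw [← Finset.sum_neg_distrib]
  refine Finset.sum_congr rfl fun n _ => ?_
  have h : (-1 : ℝ) ^ ((n : ℕ) : ℤ) = -1 := by rw [zpow_natCast, n.2.neg_one_pow]
  rw [zpow_add₀ (by norm_num), negOnePow_neg, h, neg_add, neg_neg]
  module

/-- The operator `∑ t_n σ^n` on bounded sequences, where `σ` is the shift. -/
def posShift (t : Miwa) : (ℤ →ᵇ FockL2) →L[ℝ] (ℤ →ᵇ FockL2) :=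
  Finsupp.linearCombination ℝ shift (posSymbol t)

lemma posShift_apply (t : Miwa) (f : ℤ →ᵇ FockL2) (b : ℤ) :
    posShift t f b = t.sum fun n c => c • f (b - (n : ℕ)) := by
  rw [posShift, linearCombination_posSymbol]
  simp only [Finsupp.sum, sum_apply, smul_apply,
    BoundedContinuousFunction.coe_sum, Finset.sum_apply, BoundedContinuousFunction.coe_smul,
    shift_apply]

/-- Composition of a field with the raising operator. -/
def fieldPre (t : Miwa) : Module.End ℝ (Fock →ₗ[ℝ] (ℤ →ᵇ FockL2)) :=
  LinearMap.lcomp ℝ _ (raising t)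

/-- Composition of a field with `-∑ t_n σ^n`. -/
def fieldPost (t : Miwa) : Module.End ℝ (Fock →ₗ[ℝ] (ℤ →ᵇ FockL2)) :=
  LinearMap.llcomp ℝ _ _ _ (-posShift t).toLinearMap

lemma fieldPre_apply (t : Miwa) (G : Fock →ₗ[ℝ] (ℤ →ᵇ FockL2)) (v : Fock) :
    fieldPre t G v = G (raising t v) := rfl

lemma fieldPost_apply (t : Miwa) (G : Fock →ₗ[ℝ] (ℤ →ᵇ FockL2)) (v : Fock) :
    fieldPost t G v = (-posShift t) (G v) := rfl

lemma fieldPre_pow_mul_fieldPost_pow (t : Miwa) (i j : ℕ) (G : Fock →ₗ[ℝ] (ℤ →ᵇ FockL2))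
    (v : Fock) : (fieldPre t ^ i * fieldPost t ^ j) G v
      = ((-posShift t) ^ j) (G ((raising t ^ i) v)) := by
  rw [Module.End.mul_apply]
  have h1 : ∀ (G : Fock →ₗ[ℝ] (ℤ →ᵇ FockL2)) v, (fieldPre t ^ i) G v = G ((raising t ^ i) v) := by
    intro G v
    induction i generalizing v with
    | zero => rfl
    | succ i ih =>
      rw [pow_succ', Module.End.mul_apply, fieldPre_apply, ih, pow_succ, Module.End.mul_apply]
  rw [h1]
  generalize (raising t ^ i) v = w
  induction j with
  | zero => rfl
  | succ j ih => rw [pow_succ', Module.End.mul_apply, fieldPost_apply, ih, pow_succ']; rfl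

/-- Moving powers of the raising operator past the fermion field: as `[H₋, φ_b†] = -∑ t_n φ_{b-n}†`,
each factor either acts on the state first (`fieldPre`) or shifts the field (`fieldPost`). -/
lemma toL2_raising_pow_fermionAdj (t : Miwa) (N : ℕ) (v : Fock) (b : ℤ) :
    toL2 ((raising t ^ N) (fermionAdj b v))
      = ((fieldPre t + fieldPost t) ^ N) fermionField v b := by
  induction N generalizing v b with
  | zero => rfl
  | succ N ih =>
    rw [pow_succ, Module.End.mul_apply, raising_fermionAdj, pow_succ', Module.End.mul_apply,
      map_sub, map_sub, sub_eq_add_neg]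
    simp only [LinearMap.add_apply, fieldPre_apply, fieldPost_apply, ih,
      BoundedContinuousFunction.coe_add, Pi.add_apply, neg_apply,
      BoundedContinuousFunction.coe_neg, Pi.neg_apply, posShift_apply, Finsupp.sum, map_sum,
      map_smul]

/-- The homogeneous parts of `e^{-∑ t_n σ^n}` applied to the fermion field in the coherent state
vanish at positive indices, because there the field annihilates the vacuum. -/
lemma sum_antidiagonal_field_eq_zero (t : Miwa) (N : ℕ) {b : ℤ} (hb : 0 < b) :
    ∑ m ∈ Finset.HasAntidiagonal.antidiagonal N, (((m.1 ! : ℝ)⁻¹ • (-posShift t) ^ m.1)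
      (fermionField (coherentTerm t m.2))) b = 0 := by
  have h0 : fermionAdj b vacuum = 0 := by
    rw [fermionAdj, LinearMap.smul_apply, fermion_vacuum_of_neg (by omega), smul_zero]
  have h := toL2_raising_pow_fermionAdj t N vacuum b
  have hcomm : Commute (fieldPre t) (fieldPost t) := by
    ext G v : 2; rfl
  rw [h0, map_zero, map_zero, add_comm, hcomm.symm.add_pow', LinearMap.sum_apply,
    LinearMap.sum_apply, BoundedContinuousFunction.coe_sum, Finset.sum_apply] at h
  have hN : (N ! : ℝ) ≠ 0 := by positivity
  refine (smul_eq_zero.1 ?_).resolve_left hN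
  rw [Finset.smul_sum, h]
  refine Finset.sum_congr rfl fun m hm => ?_
  rw [Finset.HasAntidiagonal.mem_antidiagonal] at hm
  have h1 : (m.1 ! : ℝ) ≠ 0 := by positivity
  have h2 : (m.2 ! : ℝ) ≠ 0 := by positivity
  have e : (N.choose m.1 : ℝ) * m.1 ! * m.2 ! = N ! := by
    rw [← hm, Nat.choose_symm_add]; exact_mod_cast Nat.add_choose_mul_factorial_mul_factorial m.1 m.2
  have hcomm2 : fieldPost t ^ m.1 * fieldPre t ^ m.2 = fieldPre t ^ m.2 * fieldPost t ^ m.1 :=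
    (hcomm.symm.pow_pow m.1 m.2)
  rw [hcomm2, LinearMap.smul_apply, LinearMap.smul_apply, fieldPre_pow_mul_fieldPost_pow,
    coherentTerm, map_smul, ← Nat.cast_smul_eq_nsmul ℝ]
  simp only [smul_apply, map_smul, BoundedContinuousFunction.coe_smul,
    smul_smul]
  congr 1
  rw [← e]
  field_simp

/-- The transform of the sequence `φ_b† e^{H₋(t)} |0⟩` by `e^{-∑ t_n σ^n}` is `e^{H₋(t)} φ_b† |0⟩`,
which vanishes for `b > 0`. This is used termwise only, so that `e^{H₋(t)}` need not be defined as
an operator. -/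
theorem exp_neg_posShift_fieldState (t : Miwa) {b : ℤ} (hb : 0 < b) :
    NormedSpace.exp (-posShift t) (fieldState t) b = 0 := by
  set f : ℕ → ((ℤ →ᵇ FockL2) →L[ℝ] (ℤ →ᵇ FockL2)) := fun i => (i ! : ℝ)⁻¹ • (-posShift t) ^ i
    with hf
  set g : ℕ → (ℤ →ᵇ FockL2) := fun j => fermionField (coherentTerm t j) with hg
  have hfs : Summable fun i => ‖f i‖ := NormedSpace.norm_expSeries_summable' (𝕂 := ℝ) (-posShift t)
  have hgs : Summable fun j => ‖g j‖ := summable_norm_fermionField t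
  have hsum : Summable fun p : ℕ × ℕ => f p.1 (g p.2) :=
    Summable.of_norm_bounded (hfs.mul_of_nonneg hgs (fun _ => norm_nonneg _)
      fun _ => norm_nonneg _) fun p => (f p.1).le_opNorm _
  have h1 : HasSum (fun p : ℕ × ℕ => f p.1 (g p.2))
      (NormedSpace.exp (-posShift t) (fieldState t)) := by
    have e := (NormedSpace.exp_series_hasSum_exp' (𝕂 := ℝ) (-posShift t)).mapL
      (ContinuousLinearMap.apply ℝ (ℤ →ᵇ FockL2) (fieldState t))
    have e2 := hsum.hasSum.prod_fiberwise fun i => (hasSum_fieldState t).mapL (f i)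
    have e3 := e.unique e2
    rw [ContinuousLinearMap.apply_apply] at e3
    rw [e3]
    exact hsum.hasSum
  have h2 := (Finset.HasAntidiagonal.sigmaAntidiagonalEquivProd (A := ℕ)).hasSum_iff.2 h1
  have h3 := (h2.mapL (BoundedContinuousFunction.evalCLM ℝ b)).sigma
    fun N => hasSum_fintype _
  refine h3.unique ?_
  convert hasSum_zero with N
  rw [← sum_antidiagonal_field_eq_zero t N hb]
  exact Finset.sum_coe_sort (Finset.HasAntidiagonal.antidiagonal N) fun m => (f m.1 (g m.2)) b

/-- The operator `∑ t_n σ^{-n}` on bounded sequences, where `σ` is the shift. -/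
def negShift (t : Miwa) : (ℤ →ᵇ FockL2) →L[ℝ] (ℤ →ᵇ FockL2) :=
  Finsupp.linearCombination ℝ shift (negSymbol t)

lemma negShift_apply (t : Miwa) (f : ℤ →ᵇ FockL2) (b : ℤ) :
    negShift t f b = t.sum fun n c => c • f (b + (n : ℕ)) := by
  rw [negShift, linearCombination_negSymbol]
  simp only [Finsupp.sum, sum_apply, smul_apply,
    BoundedContinuousFunction.coe_sum, Finset.sum_apply, BoundedContinuousFunction.coe_smul,
    shift_apply, sub_neg_eq_add]

/-- The operator `∑ t_n (σ^n - σ^{-n})` on bounded sequences, where `σ` is the shift. -/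
def oddShift (t : Miwa) : (ℤ →ᵇ FockL2) →L[ℝ] (ℤ →ᵇ FockL2) :=
  Finsupp.linearCombination ℝ shift (oddSymbol t)

lemma oddShift_eq (t : Miwa) : oddShift t = posShift t - negShift t := by
  rw [oddShift, oddSymbol, map_sub]; rfl

/-- The Bogoliubov transform of the fermion field: its members of positive index annihilate the
coherent state. -/
def dressedState (t : Miwa) : ℤ →ᵇ FockL2 := NormedSpace.exp (-oddShift t) (fieldState t)

lemma dressedState_of_pos (t : Miwa) {b : ℤ} (hb : 0 < b) : dressedState t b = 0 := by
  have h : dressedState t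
      = NormedSpace.exp (negShift t) (NormedSpace.exp (-posShift t) (fieldState t)) := by
    let _ : NormedAlgebra ℚ ((ℤ →ᵇ FockL2) →L[ℝ] (ℤ →ᵇ FockL2)) :=
      NormedAlgebra.restrictScalars ℚ ℝ _
    have hc : Commute (negShift t) (posShift t) := commute_linearCombination_shift _ _
    rw [dressedState, oddShift_eq, neg_sub, sub_eq_add_neg,
      NormedSpace.exp_add_of_commute hc.neg_right]
    rfl
  rw [h]
  refine exp_apply_eq_zero (fun f hf b hb => ?_)
    (fun b hb => exp_neg_posShift_fieldState t hb) hb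
  rw [negShift_apply]
  exact Finset.sum_eq_zero fun n _ => by simp only [hf (b + (n : ℕ)) (by omega), smul_zero]

/-- The inverse of the Bogoliubov transform. -/
lemma hasSum_fieldState_dressed (t : Miwa) (a : ℤ) :
    HasSum (fun j => expCoeff (oddSymbol t) j • dressedState t (a - j)) (fieldState t a) := by
  have h := ((hasSum_expCoeff (oddSymbol t) shift_zero shift_add norm_shift_le).mapL
    (ContinuousLinearMap.apply ℝ (ℤ →ᵇ FockL2) (dressedState t))).mapL
    (BoundedContinuousFunction.evalCLM ℝ a)
  have e : NormedSpace.exp (oddShift t) (dressedState t) = fieldState t := by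
    let _ : NormedAlgebra ℚ ((ℤ →ᵇ FockL2) →L[ℝ] (ℤ →ᵇ FockL2)) :=
      NormedAlgebra.restrictScalars ℚ ℝ _
    change (NormedSpace.exp (oddShift t) * NormedSpace.exp (-oddShift t)) (fieldState t) = _
    rw [← NormedSpace.exp_add_of_commute
      ((Commute.refl (oddShift t)).neg_right), add_neg_cancel, NormedSpace.exp_zero]
    rfl
  have e' : ContinuousLinearMap.apply ℝ (ℤ →ᵇ FockL2) (dressedState t)
    (NormedSpace.exp (oddShift t)) = fieldState t := e
  rw [← e']
  exact h

/-- The Bogoliubov transform as a convolution; `e^{-q(σ)} = e^{q(σ⁻¹)}` for `q = oddSymbol t`. -/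
lemma hasSum_dressedState (t : Miwa) (a : ℤ) :
    HasSum (fun j => expCoeff (oddSymbol t) j • fieldState t (a + j)) (dressedState t a) := by
  have h := ((hasSum_expCoeff (oddSymbol t) (s := fun k => shift (E := FockL2) (-k))
    (by simp [shift_zero]) (fun k l => by rw [neg_add, shift_add])
    (fun k => norm_shift_le _)).mapL
    (ContinuousLinearMap.apply ℝ (ℤ →ᵇ FockL2) (fieldState t))).mapL
    (BoundedContinuousFunction.evalCLM ℝ a)
  rw [linearCombination_oddSymbol_neg] at h
  have e : (fun j => expCoeff (oddSymbol t) j • fieldState t (a + j))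
      = fun j => expCoeff (oddSymbol t) j • fieldState t (a - -j) := by
    simp only [sub_neg_eq_add]
  rw [e]
  exact h

/-- The Bogoliubov transform as another convolution; `e^{-q(σ)} = e^{q(-σ)}` for `q = oddSymbol t`.
-/
lemma hasSum_dressedState_alternate (t : Miwa) (a : ℤ) :
    HasSum (fun j => expCoeff (oddSymbol t) j • (-1 : ℝ) ^ j • fieldState t (a - j))
      (dressedState t a) := by
  have h := ((hasSum_expCoeff (oddSymbol t) (s := fun k => (-1 : ℝ) ^ k • shift (E := FockL2) k)
    (by simp [shift_zero]) (fun k l => by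
      rw [shift_add, zpow_add₀ (by norm_num), smul_mul_smul_comm])
    (fun k => by
      rw [norm_smul, norm_zpow, norm_neg, norm_one, one_zpow, one_mul]
      exact norm_shift_le _)).mapL
    (ContinuousLinearMap.apply ℝ (ℤ →ᵇ FockL2) (fieldState t))).mapL
    (BoundedContinuousFunction.evalCLM ℝ a)
  rw [linearCombination_oddSymbol_alternate] at h
  exact h

/-! ### Gram matrices of Bogoliubov transforms -/

section Gram

variable {E : Type*} [NormedAddCommGroup E] [InnerProductSpace ℝ E]

/-- If the vectors `X a` satisfy the anticommutation relations of fermions in a state, then so do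
the vectors `Y a` obtained from them by convolution with an orthonormal kernel `J`. The two forms of
the convolution match the two terms of the relations; they agree if `J_{-j} = (-1)^j J_j`. -/
lemma inner_bogoliubov_add {X Y : ℤ → E} {J : ℤ → ℝ} {Z : ℝ}
    (hX : ∀ a b, inner ℝ (X a) (X b) + (-1 : ℝ) ^ (a + b) * inner ℝ (X (-b)) (X (-a))
      = if a = b then Z else 0)
    (hY : ∀ a, HasSum (fun j => J j • X (a + j)) (Y a))
    (hY' : ∀ a, HasSum (fun j => J j • (-1 : ℝ) ^ j • X (a - j)) (Y a))
    (hJ : ∀ k, HasSum (fun j => J j * J (j + k)) (if k = 0 then 1 else 0)) (a b : ℤ) :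
    inner ℝ (Y a) (Y b) + (-1 : ℝ) ^ (a + b) * inner ℝ (Y (-b)) (Y (-a))
      = if a = b then Z else 0 := by
  -- The relations with only one of the two vectors transformed.
  have step : ∀ a b, inner ℝ (Y a) (X b) + (-1 : ℝ) ^ (a + b) * inner ℝ (X (-b)) (Y (-a))
      = Z * J (b - a) := by
    intro a b
    have h1 := (hY a).mapL (innerSL ℝ (X b))
    have h2 := ((hY' (-a)).mapL (innerSL ℝ (X (-b)))).mul_left ((-1 : ℝ) ^ (a + b))
    have h3 := h1.add h2
    simp only [innerSL_apply_apply] at h3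
    rw [real_inner_comm]
    have e : ∀ j, inner ℝ (X b) (J j • X (a + j))
        + (-1 : ℝ) ^ (a + b) * inner ℝ (X (-b)) (J j • (-1 : ℝ) ^ j • X (-a - j))
        = J j * (if a + j = b then Z else 0) := by
      intro j
      rw [← hX (a + j) b, inner_smul_right, inner_smul_right, inner_smul_right, real_inner_comm,
        show -(a + j) = -a - j by ring, show a + j + b = a + b + j by ring,
        zpow_add₀ (by norm_num) (a + b)]
      ring
    have h4 : HasSum (fun j => J j * (if a + j = b then Z else 0)) (Z * J (b - a)) := by
      convert hasSum_single (b - a) _ using 1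
      · simp [mul_comm]
      · intro j hj
        rw [if_neg (by omega), mul_zero]
    exact h3.unique (by simpa only [e] using h4)
  have h1 := (hY b).mapL (innerSL ℝ (Y a))
  have h2 := ((hY' (-b)).mapL (innerSL ℝ (Y (-a)))).mul_left ((-1 : ℝ) ^ (a + b))
  have h3 := h1.add h2
  simp only [innerSL_apply_apply] at h3
  have e : ∀ j, inner ℝ (Y a) (J j • X (b + j))
      + (-1 : ℝ) ^ (a + b) * inner ℝ (Y (-a)) (J j • (-1 : ℝ) ^ j • X (-b - j))
      = Z * (J j * J (j + (b - a))) := by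
    intro j
    have := step a (b + j)
    rw [show b + j - a = j + (b - a) by ring] at this
    rw [mul_left_comm, ← this, inner_smul_right, inner_smul_right, inner_smul_right,
      real_inner_comm (X (-b - j)), show -(b + j) = -b - j by ring,
      show a + (b + j) = a + b + j by ring, zpow_add₀ (by norm_num) (a + b)]
    ring
  rw [real_inner_comm (Y (-a)) (Y (-b))]
  have h4 := (hJ (b - a)).mul_left Z
  simp only [e] at h3
  rw [h3.unique h4]
  by_cases hab : a = b
  · rw [if_pos (by omega), if_pos hab, mul_one]
  · rw [if_neg (by omega), if_neg hab, mul_zero]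

/-- The squared lengths of fermions in a quasi-free state: the transformed fermions `Y a` behave
like fermions in the vacuum, those of positive index being zero. -/
lemma hasSum_norm_sq_bogoliubov {X Y : ℤ → E} {J : ℤ → ℝ} {Z : ℝ}
    (hY : ∀ a b, inner ℝ (Y a) (Y b) + (-1 : ℝ) ^ (a + b) * inner ℝ (Y (-b)) (Y (-a))
      = if a = b then Z else 0)
    (hpos : ∀ b > 0, Y b = 0)
    (hX : ∀ a, HasSum (fun j => J j • Y (a - j)) (X a)) (a : ℤ) :
    HasSum (fun j => Z * (J j ^ 2 * vacuumOccupation (j - a))) (‖X a‖ ^ 2) := by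
  -- In the relation between `Y b` and `Y c` at most one of the two inner products is nonzero,
  -- except for `b = c = 0`, where they coincide; so the Gram matrix is diagonal.
  have hYY : ∀ b c, inner ℝ (Y b) (Y c) = if b = c then Z * vacuumOccupation (-b) else 0 := by
    intro b c
    have h := hY b c
    by_cases hbc : b = c
    · subst hbc
      rw [if_pos rfl] at h ⊢
      have h2 : (-1 : ℝ) ^ (b + b) = 1 := by rw [zpow_add₀ (by norm_num), negOnePow_mul_self]
      rw [h2, one_mul] at h
      rcases lt_trichotomy b 0 with hb | hb | hb
      · rw [hpos (-b) (by omega), inner_zero_left, add_zero] at h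
        rw [h, vacuumOccupation, if_pos (by omega), mul_one]
      · subst hb
        simp only [neg_zero] at h ⊢
        rw [vacuumOccupation, if_neg (lt_irrefl _), if_pos rfl]
        linarith
      · rw [hpos b hb, inner_zero_left, vacuumOccupation, if_neg (by omega), if_neg (by omega),
          mul_zero]
    · rw [if_neg hbc] at h ⊢
      by_cases hb : 0 < b
      · rw [hpos b hb, inner_zero_left]
      by_cases hc : 0 < c
      · rw [hpos c hc, inner_zero_right]
      rcases lt_or_ge b 0 with hb' | hb'
      · rw [hpos (-b) (by omega), inner_zero_right] at h
        linarith
      · rw [hpos (-c) (by omega), inner_zero_left] at h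
        linarith
  have hYX : ∀ b, inner ℝ (Y b) (X a) = J (a - b) * (Z * vacuumOccupation (-b)) := by
    intro b
    have h := (hX a).mapL (innerSL ℝ (Y b))
    simp only [innerSL_apply_apply, inner_smul_right, hYY] at h
    refine h.unique ?_
    convert hasSum_single (a - b) _ using 1
    · simp
    · intro j hj
      rw [if_neg (by omega), mul_zero]
  have h := (hX a).mapL (innerSL ℝ (X a))
  simp only [innerSL_apply_apply, inner_smul_right] at h
  rw [real_inner_self_eq_norm_sq] at h
  have e : (fun j => Z * (J j ^ 2 * vacuumOccupation (j - a)))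
      = fun j => J j * inner ℝ (X a) (Y (a - j)) := by
    funext j
    rw [real_inner_comm, hYX, show a - (a - j) = j by ring, neg_sub]
    ring
  rw [e]
  exact h

end Gram

/-! ### Absolutely convergent Fourier series -/

lemma integral_exp_int_mul (n : ℤ) :
    ∫ θ in (0 : ℝ)..(2 * Real.pi), Complex.exp (n * θ * Complex.I)
      = if n = 0 then 2 * (Real.pi : ℂ) else 0 := by
  by_cases hn : n = 0
  · subst hn; simp
  · rw [if_neg hn]
    have hc : (n : ℂ) * Complex.I ≠ 0 := by simp [hn]
    have := integral_exp_mul_complex (a := 0) (b := 2 * Real.pi) hc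
    simp only [show ∀ θ : ℝ, (n : ℂ) * θ * Complex.I = n * Complex.I * θ from fun θ => by ring]
    rw [this]
    have e : Complex.exp ((n : ℂ) * Complex.I * ((2 * Real.pi : ℝ) : ℂ)) = 1 := by
      rw [Complex.exp_eq_one_iff]; exact ⟨n, by push_cast; ring⟩
    rw [e]; simp

/-- Parseval's identity for absolutely convergent Fourier series. -/
theorem hasSum_parseval {c d : ℤ → ℂ} (hc : Summable fun j => ‖c j‖) (hd : Summable fun j => ‖d j‖)
    {f g : ℝ → ℂ} (hf : ∀ θ : ℝ, HasSum (fun j : ℤ => c j * Complex.exp (j * θ * Complex.I)) (f θ))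
    (hg : ∀ θ : ℝ, HasSum (fun j : ℤ => d j * Complex.exp (-(j * θ * Complex.I))) (g θ)) :
    HasSum (fun j => c j * d j)
      (1 / (2 * Real.pi) * ∫ θ in (0 : ℝ)..(2 * Real.pi), f θ * g θ) := by
  have hpi : (2 * Real.pi : ℂ) ≠ 0 := by exact_mod_cast Real.two_pi_pos.ne'
  have hnorm : ∀ (j : ℤ) (θ : ℝ), ‖Complex.exp (j * θ * Complex.I)‖ = 1 := by
    intro j θ
    have := Complex.norm_exp_ofReal_mul_I (j * θ)
    push_cast at this; exact this
  have hnorm' : ∀ (j : ℤ) (θ : ℝ), ‖Complex.exp (-(j * θ * Complex.I))‖ = 1 := by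
    intro j θ
    have := hnorm (-j) θ
    push_cast at this; rw [← this]; congr 2; ring
  have hfc : Continuous f := by
    have : f = fun θ : ℝ => ∑' j : ℤ, c j * Complex.exp (j * θ * Complex.I) :=
      funext fun θ => (hf θ).tsum_eq.symm
    rw [this]
    refine continuous_tsum (fun j => by fun_prop) hc fun j θ => ?_
    rw [norm_mul, hnorm, mul_one]
  have hfb : ∀ θ, ‖f θ‖ ≤ ∑' j, ‖c j‖ := by
    intro θ
    rw [← (hf θ).tsum_eq]
    refine tsum_of_norm_bounded hc.hasSum fun j => ?_
    rw [norm_mul, hnorm, mul_one]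
  -- The Fourier coefficients of `f`.
  have hcoef : ∀ k : ℤ, ∫ θ in (0 : ℝ)..(2 * Real.pi), f θ * Complex.exp (-(k * θ * Complex.I))
      = 2 * Real.pi * c k := by
    intro k
    have h := intervalIntegral.hasSum_integral_of_dominated_convergence (μ := volume)
      (a := 0) (b := 2 * Real.pi)
      (F := fun (j : ℤ) (θ : ℝ) => c j * Complex.exp (j * θ * Complex.I)
        * Complex.exp (-(k * θ * Complex.I)))
      (f := fun θ => f θ * Complex.exp (-(k * θ * Complex.I)))
      (bound := fun j _ => ‖c j‖)
      (fun j => by fun_prop)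
      (fun j => ae_of_all _ fun θ _ => by rw [norm_mul, norm_mul, hnorm, hnorm', mul_one, mul_one])
      (ae_of_all _ fun θ _ => hc) (by simp) (ae_of_all _ fun θ _ => (hf θ).mul_right _)
    refine h.unique ?_
    convert hasSum_single k _ using 1
    · simp only [mul_assoc, ← Complex.exp_add]
      simp
      ring
    · intro j hj
      simp only [mul_assoc, ← Complex.exp_add]
      rw [intervalIntegral.integral_const_mul]
      have := integral_exp_int_mul (j - k)
      rw [if_neg (sub_ne_zero.2 hj)] at this
      convert mul_zero (c j) using 2
      rw [← this]
      congr 1; ext θ; congr 1; push_cast; ring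
  have h := intervalIntegral.hasSum_integral_of_dominated_convergence (μ := volume)
      (a := 0) (b := 2 * Real.pi)
      (F := fun (j : ℤ) (θ : ℝ) => f θ * (d j * Complex.exp (-(j * θ * Complex.I))))
      (f := fun θ => f θ * g θ)
      (bound := fun j _ => (∑' j, ‖c j‖) * ‖d j‖)
      (fun j => by fun_prop)
      (fun j => ae_of_all _ fun θ _ => by
        rw [norm_mul, norm_mul, hnorm', mul_one]
        exact mul_le_mul_of_nonneg_right (hfb θ) (norm_nonneg _))
      (ae_of_all _ fun θ _ => hd.mul_left _) (by simp) (ae_of_all _ fun θ _ => (hg θ).mul_left _)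
  have h2 := h.mul_left (1 / (2 * Real.pi : ℂ))
  have e : (fun j => c j * d j) = fun j => 1 / (2 * Real.pi : ℂ) *
      ∫ θ in (0 : ℝ)..(2 * Real.pi), f θ * (d j * Complex.exp (-(j * θ * Complex.I))) := by
    funext j
    simp only [mul_left_comm (f _)]
    rw [intervalIntegral.integral_const_mul, hcoef]
    field_simp
  rw [e]
  exact h2

/-- The phase `g(θ) = 2 ∑ t_n sin (n θ)`. -/
def phase (t : Miwa) (θ : ℝ) : ℝ := 2 * t.sum fun n c => c * Real.sin (n * θ)

lemma continuous_phase (t : Miwa) : Continuous (phase t) := by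
  unfold phase Finsupp.sum; fun_prop

/-- The Fourier coefficients of `e^{i g(θ)}`, where `g` is the phase. -/
abbrev besselCoeff (t : Miwa) (j : ℤ) : ℝ := expCoeff (oddSymbol t) j

lemma hasSum_besselCoeff (t : Miwa) (θ : ℝ) :
    HasSum (fun j : ℤ => (besselCoeff t j : ℂ) * Complex.exp (j * θ * Complex.I))
      (Complex.exp (phase t θ * Complex.I)) := by
  have h := hasSum_expCoeff (oddSymbol t) (s := fun j : ℤ => Complex.exp (j * θ * Complex.I))
    (by simp) (fun k l => by rw [← Complex.exp_add]; congr 1; push_cast; ring) (fun k => by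
      have := Complex.norm_exp_ofReal_mul_I (k * θ)
      push_cast at this; exact this.le)
  have e : Finsupp.linearCombination ℝ (fun j : ℤ => Complex.exp (j * θ * Complex.I)) (oddSymbol t)
      = phase t θ * Complex.I := by
    rw [oddSymbol, map_sub, linearCombination_posSymbol, linearCombination_negSymbol, phase]
    simp only [Finsupp.sum]
    push_cast
    rw [← Finset.sum_sub_distrib, Finset.mul_sum, Finset.sum_mul]
    refine Finset.sum_congr rfl fun n _ => ?_
    rw [← smul_sub, Complex.real_smul, Complex.sin]
    ring_nf
    simp
    ring_nf
  rw [e, ← Complex.exp_eq_exp_ℂ] at h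
  simpa only [Complex.real_smul] using h

lemma summable_besselCoeff (t : Miwa) : Summable fun j => ‖(besselCoeff t j : ℂ)‖ := by
  simpa using summable_expCoeff (oddSymbol t)

lemma hasSum_besselCoeff_neg (t : Miwa) (θ : ℝ) :
    HasSum (fun j : ℤ => (besselCoeff t j : ℂ) * Complex.exp (-(j * θ * Complex.I)))
      (Complex.exp (-(phase t θ * Complex.I))) := by
  have h := (hasSum_besselCoeff t θ).star
  convert h using 2 with j
  · simp [← Complex.exp_conj]
  · simp [← Complex.exp_conj]

/-- The characteristic function of the weights `J_j²` is the correlation of `e^{i g}` with its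
translate. -/
theorem hasSum_besselCoeff_charFun (t : Miwa) (k : ℤ) (s : ℝ) :
    HasSum (fun j : ℤ => (besselCoeff t j * besselCoeff t (j + k) : ℂ)
        * Complex.exp (j * s * Complex.I))
      (1 / (2 * Real.pi) * ∫ θ in (0 : ℝ)..(2 * Real.pi),
        Complex.exp ((phase t (θ + s) - phase t θ) * Complex.I) * Complex.exp (k * θ * Complex.I)) := by
  have hn : ∀ j : ℤ, ‖Complex.exp (j * s * Complex.I)‖ = 1 := fun j => by
    have := Complex.norm_exp_ofReal_mul_I (j * s)
    push_cast at this; exact this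
  have h := hasSum_parseval
    (c := fun j => (besselCoeff t j : ℂ) * Complex.exp (j * s * Complex.I))
    (d := fun j => (besselCoeff t (j + k) : ℂ))
    (f := fun θ => Complex.exp (phase t (θ + s) * Complex.I))
    (g := fun θ => Complex.exp (-(phase t θ * Complex.I)) * Complex.exp (k * θ * Complex.I))
    (by simpa only [norm_mul, hn, mul_one] using summable_besselCoeff t)
    ((Equiv.addRight k).summable_iff.2 (summable_besselCoeff t))
    (fun θ => by
      convert hasSum_besselCoeff t (θ + s) using 2 with j
      rw [mul_assoc, ← Complex.exp_add]
      congr 2; push_cast; ring)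
    (fun θ => by
      have h1 := ((Equiv.addRight k).hasSum_iff.2 (hasSum_besselCoeff_neg t θ)).mul_right
        (Complex.exp (k * θ * Complex.I))
      have e : (fun j : ℤ => (besselCoeff t (j + k) : ℂ) * Complex.exp (-(j * θ * Complex.I)))
          = fun j : ℤ => (besselCoeff t (j + k) : ℂ) *
          Complex.exp (-(((j + k : ℤ) : ℂ) * θ * Complex.I)) * Complex.exp (k * θ * Complex.I) := by
        funext j
        rw [mul_assoc (besselCoeff t (j + k) : ℂ) (Complex.exp _) (Complex.exp _),
          ← Complex.exp_add]
        congr 2; push_cast; ring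
      rw [e]
      exact h1)
  convert h using 2 with j
  · ring
  · congr 1; ext θ
    simp only [← Complex.exp_add]
    congr 1; ring

lemma hasSum_besselCoeff_orthonormal (t : Miwa) (k : ℤ) :
    HasSum (fun j => besselCoeff t j * besselCoeff t (j + k)) (if k = 0 then 1 else 0) := by
  have h := hasSum_besselCoeff_charFun t k 0
  simp only [add_zero, sub_self, zero_mul, mul_zero, Complex.exp_zero, one_mul, mul_one,
    Complex.ofReal_zero, integral_exp_int_mul] at h
  have hpi : (2 * Real.pi : ℂ) ≠ 0 := by exact_mod_cast Real.two_pi_pos.ne'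
  rw [← Complex.hasSum_ofReal]
  convert h using 1
  · push_cast; rfl
  · split_ifs
    · rw [one_div, inv_mul_cancel₀ hpi, Complex.ofReal_one]
    · simp

/-! ### The second moment of the weights -/

/-- The derivative `2 ∑ n t_n cos (n θ)` of the phase. -/
def velocity (t : Miwa) (θ : ℝ) : ℝ := 2 * t.sum fun n c => (n : ℝ) * c * Real.cos (n * θ)

/-- A bound for the derivative of the phase. -/
def velocityBound (t : Miwa) : ℝ := 2 * t.sum fun n c => (n : ℝ) * |c|

lemma hasDerivAt_phase (t : Miwa) (θ : ℝ) : HasDerivAt (phase t) (velocity t θ) θ := by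
  unfold phase velocity Finsupp.sum
  refine HasDerivAt.const_mul _ (HasDerivAt.fun_sum fun n _ => ?_)
  have h : HasDerivAt (fun θ : ℝ => ((n : ℕ) : ℝ) * θ) (n : ℕ) θ := by
    simpa using (hasDerivAt_id θ).const_mul ((n : ℕ) : ℝ)
  exact (h.sin.const_mul (t n)).congr_deriv (by ring)

lemma continuous_velocity (t : Miwa) : Continuous (velocity t) := by
  unfold velocity Finsupp.sum; fun_prop

lemma abs_velocity_le (t : Miwa) (θ : ℝ) : |velocity t θ| ≤ velocityBound t := by
  unfold velocity velocityBound Finsupp.sum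
  rw [abs_mul, abs_two]
  refine mul_le_mul_of_nonneg_left ((Finset.abs_sum_le_sum_abs _ _).trans
    (Finset.sum_le_sum fun n _ => ?_)) (by norm_num)
  rw [abs_mul, abs_mul, Nat.abs_cast]
  exact mul_le_of_le_one_right (by positivity) (Real.abs_cos_le_one _)

lemma abs_phase_sub_le (t : Miwa) (θ s : ℝ) :
    |phase t (θ + s) - phase t θ| ≤ velocityBound t * |s| := by
  have h := Convex.norm_image_sub_le_of_norm_hasDerivWithin_le (s := univ) (x := θ) (y := θ + s)
    (fun θ _ => (hasDerivAt_phase t θ).hasDerivWithinAt) (fun θ _ => abs_velocity_le t θ)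
    convex_univ (mem_univ _) (mem_univ _)
  simpa using h

lemma hasSum_besselCoeff_sq (t : Miwa) : HasSum (fun j => besselCoeff t j ^ 2) 1 := by
  simpa [sq] using hasSum_besselCoeff_orthonormal t 0

lemma hasSum_besselCoeff_cos (t : Miwa) (s : ℝ) :
    HasSum (fun j : ℤ => besselCoeff t j ^ 2 * Real.cos (j * s))
      (1 / (2 * Real.pi) * ∫ θ in (0 : ℝ)..(2 * Real.pi), Real.cos (phase t (θ + s) - phase t θ)) := by
  have h := Complex.reCLM.hasSum (hasSum_besselCoeff_charFun t 0 s)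
  have e1 : ∀ x : ℝ, (Complex.exp (x * Complex.I)).re = Real.cos x := Complex.exp_ofReal_mul_I_re
  have hc := continuous_phase t
  have e2 : (1 / (2 * Real.pi) * ∫ θ in (0 : ℝ)..(2 * Real.pi),
        Complex.exp ((phase t (θ + s) - phase t θ) * Complex.I)
          * Complex.exp ((0 : ℤ) * θ * Complex.I)).re
      = 1 / (2 * Real.pi) * ∫ θ in (0 : ℝ)..(2 * Real.pi),
        Real.cos (phase t (θ + s) - phase t θ) := by
    have e3 : (1 / (2 * Real.pi) : ℂ) = ((1 / (2 * Real.pi) : ℝ) : ℂ) := by push_cast; rfl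
    rw [e3, Complex.re_ofReal_mul]
    congr 1
    have hi : IntervalIntegrable (fun θ : ℝ => Complex.exp ((phase t (θ + s) - phase t θ)
        * Complex.I) * Complex.exp ((0 : ℤ) * θ * Complex.I)) volume 0 (2 * Real.pi) :=
      Continuous.intervalIntegrable (by fun_prop) _ _
    have := Complex.reCLM.intervalIntegral_comp_comm hi
    rw [Complex.reCLM_apply] at this
    rw [← this]
    congr 1; ext θ
    rw [← e1, Complex.ofReal_sub]
    simp
  have e4 : (fun j : ℤ => besselCoeff t j ^ 2 * Real.cos (j * s))
      = fun j : ℤ => Complex.reCLM ((besselCoeff t j * besselCoeff t (j + 0) : ℂ)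
        * Complex.exp (j * s * Complex.I)) := by
    funext j
    have := e1 (j * s)
    push_cast at this
    rw [Complex.reCLM_apply, ← Complex.ofReal_mul, Complex.re_ofReal_mul, this, add_zero, sq]
  rw [e4, ← e2]
  exact h

/-- The weights `J_j²` have a second moment, bounded by the square of the velocity: compare the
second order terms in `s` of `∑ J_j² cos (j s)` and of the mean of `cos (g(θ + s) - g(θ))`. -/
theorem sum_besselCoeff_sq_mul_sq_le (t : Miwa) (F : Finset ℤ) :
    ∑ j ∈ F, besselCoeff t j ^ 2 * (j : ℝ) ^ 2 ≤ velocityBound t ^ 2 := by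
  have key : ∀ s : ℝ, ∑ j ∈ F, besselCoeff t j ^ 2 * (2 * (1 - Real.cos (j * s)))
      ≤ (velocityBound t * |s|) ^ 2 := by
    intro s
    have h := ((hasSum_besselCoeff_sq t).sub (hasSum_besselCoeff_cos t s)).mul_left 2
    have h0 : ∀ j : ℤ, besselCoeff t j ^ 2 * (2 * (1 - Real.cos (j * s)))
        = 2 * (besselCoeff t j ^ 2 - besselCoeff t j ^ 2 * Real.cos (j * s)) := fun j => by ring
    simp only [h0]
    refine (sum_le_hasSum F (fun j _ => ?_) h).trans ?_
    · rw [← h0]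
      have := Real.cos_le_one (j * s)
      have : 0 ≤ 1 - Real.cos (j * s) := by linarith
      positivity
    · have hc := continuous_phase t
      have hle : ∫ θ in (0 : ℝ)..(2 * Real.pi), (1 - (velocityBound t * |s|) ^ 2 / 2)
          ≤ ∫ θ in (0 : ℝ)..(2 * Real.pi), Real.cos (phase t (θ + s) - phase t θ) := by
        refine intervalIntegral.integral_mono_on Real.two_pi_pos.le (by simp)
          (Continuous.intervalIntegrable (by fun_prop) _ _) fun θ _ => ?_
        have h1 := abs_phase_sub_le t θ s
        have h2 : (phase t (θ + s) - phase t θ) ^ 2 ≤ (velocityBound t * |s|) ^ 2 :=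
          sq_le_sq' (abs_le.1 h1).1 (abs_le.1 h1).2
        have h3 := Real.one_sub_sq_div_two_le_cos (x := phase t (θ + s) - phase t θ)
        linarith
      rw [intervalIntegral.integral_const, sub_zero, smul_eq_mul] at hle
      have hpi := Real.two_pi_pos
      have h4 : 1 / (2 * Real.pi) * (2 * Real.pi * (1 - (velocityBound t * |s|) ^ 2 / 2))
          ≤ 1 / (2 * Real.pi) * ∫ θ in (0 : ℝ)..(2 * Real.pi),
            Real.cos (phase t (θ + s) - phase t θ) :=
        mul_le_mul_of_nonneg_left hle (by positivity)
      rw [← mul_assoc, one_div_mul_cancel hpi.ne', one_mul] at h4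
      linarith
  -- Divide by `s²` and let `s` tend to zero.
  have hlim : Tendsto (fun s : ℝ => ∑ j ∈ F, besselCoeff t j ^ 2 *
      (2 * (s⁻¹ • (Real.sin (j * (0 + s) / 2) - Real.sin (j * 0 / 2)))) ^ 2) (𝓝[≠] 0)
      (𝓝 (∑ j ∈ F, besselCoeff t j ^ 2 * (2 * ((j : ℝ) / 2)) ^ 2)) := by
    refine tendsto_finsetSum _ fun j _ => ((Tendsto.const_mul 2 ?_).pow 2).const_mul _
    have h : HasDerivAt (fun s : ℝ => Real.sin (j * s / 2)) ((j : ℝ) / 2) 0 := by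
      have h1 : HasDerivAt (fun s : ℝ => (j : ℝ) * s / 2) ((j : ℝ) / 2) 0 := by
        simpa using ((hasDerivAt_id (0 : ℝ)).const_mul (j : ℝ)).div_const 2
      simpa using h1.sin
    exact h.tendsto_slope_zero
  have e : ∀ j : ℤ, besselCoeff t j ^ 2 * (2 * ((j : ℝ) / 2)) ^ 2
      = besselCoeff t j ^ 2 * (j : ℝ) ^ 2 := fun j => by ring
  simp only [e] at hlim
  refine le_of_tendsto hlim ?_
  filter_upwards [self_mem_nhdsWithin] with s hs
  have hs' : s ≠ 0 := hs
  have h1 := key s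
  have h2 : ∀ j : ℤ, besselCoeff t j ^ 2 *
      (2 * (s⁻¹ • (Real.sin (j * (0 + s) / 2) - Real.sin (j * 0 / 2)))) ^ 2
      = (besselCoeff t j ^ 2 * (2 * (1 - Real.cos (j * s)))) * (s ^ 2)⁻¹ := by
    intro j
    have h3 : Real.cos (j * s) = 1 - 2 * Real.sin (j * s / 2) ^ 2 := by
      rw [show (j : ℝ) * s = 2 * (j * s / 2) by ring, Real.cos_two_mul, Real.cos_sq']; ring_nf
    rw [h3]
    simp
    ring
  simp only [h2]
  rw [← Finset.sum_mul, mul_inv_le_iff₀ (by positivity)]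
  rw [mul_pow, sq_abs] at h1
  exact h1

lemma summable_besselCoeff_sq_mul_sq (t : Miwa) :
    Summable fun j : ℤ => besselCoeff t j ^ 2 * (j : ℝ) ^ 2 :=
  summable_of_sum_le (fun _ => by positivity) (sum_besselCoeff_sq_mul_sq_le t)

lemma tsum_besselCoeff_sq_mul_sq_le (t : Miwa) :
    ∑' j : ℤ, besselCoeff t j ^ 2 * (j : ℝ) ^ 2 ≤ velocityBound t ^ 2 :=
  Real.tsum_le_of_sum_le (fun _ => by positivity) (sum_besselCoeff_sq_mul_sq_le t)

/-! ### The limit law of the rescaled weights -/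

section SumDirac

variable {ι α : Type*} [MeasurableSpace α]

/-- The measure with an atom of mass `w i` at each `x i`. -/
def atomic (w : ι → ℝ) (x : ι → α) : Measure α :=
  Measure.sum fun i => ENNReal.ofReal (w i) • Measure.dirac (x i)

variable {E : Type*} [NormedAddCommGroup E]

lemma integral_atom [NormedSpace ℝ E] [CompleteSpace E] {w : ℝ} (hw : 0 ≤ w) (x : α) {f : α → E}
    (hf : StronglyMeasurable f) :
    ∫ y, f y ∂(ENNReal.ofReal w • Measure.dirac x) = w • f x := by
  rw [integral_smul_measure, integral_dirac' _ _ hf, ENNReal.toReal_ofReal hw]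

lemma integrable_atomic [Countable ι] {w : ι → ℝ} (hw : ∀ i, 0 ≤ w i) (x : ι → α) {f : α → E}
    (hf : StronglyMeasurable f) (hs : Summable fun i => w i * ‖f (x i)‖) :
    Integrable f (atomic w x) := by
  refine integrable_sum_measure (fun i => ?_) ?_
  · refine Integrable.smul_measure ?_ ENNReal.ofReal_ne_top
    refine ⟨hf.aestronglyMeasurable, ?_⟩
    rw [HasFiniteIntegral, lintegral_dirac' _ hf.enorm]
    exact enorm_lt_top
  · convert hs using 2 with i
    rw [integral_atom (hw i) _ hf.norm, smul_eq_mul]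

lemma hasSum_integral_atomic [Countable ι] [NormedSpace ℝ E] [CompleteSpace E] {w : ι → ℝ}
    (hw : ∀ i, 0 ≤ w i) (x : ι → α) {f : α → E} (hf : StronglyMeasurable f)
    (hs : Summable fun i => w i * ‖f (x i)‖) :
    HasSum (fun i => w i • f (x i)) (∫ y, f y ∂(atomic w x)) := by
  have h := hasSum_integral_measure (integrable_atomic hw x hf hs)
  simp only [integral_atom (hw _) _ hf] at h
  exact h

lemma isProbabilityMeasure_atomic {w : ι → ℝ} (hw : ∀ i, 0 ≤ w i) (x : ι → α) (h1 : HasSum w 1) :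
    IsProbabilityMeasure (atomic w x) := by
  constructor
  rw [atomic, Measure.sum_apply _ MeasurableSet.univ]
  simp only [Measure.smul_apply, measure_univ, smul_eq_mul, mul_one]
  rw [← ENNReal.ofReal_tsum_of_nonneg hw h1.summable, h1.tsum_eq, ENNReal.ofReal_one]

end SumDirac

/-- The distribution of `ε j`, where `j` has the probability `J_j(t/ε)²`. -/
def rescaledLaw (t : Miwa) (ε : ℝ) : Measure ℝ :=
  atomic (fun j : ℤ => besselCoeff (ε⁻¹ • t) j ^ 2) fun j => ε * j

instance (t : Miwa) (ε : ℝ) : IsProbabilityMeasure (rescaledLaw t ε) :=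
  isProbabilityMeasure_atomic (fun _ => sq_nonneg _) _ (hasSum_besselCoeff_sq _)

/-- The distribution of the velocity at a uniformly distributed angle. -/
def velocityLaw (t : Miwa) : Measure ℝ :=
  (ENNReal.ofReal (1 / (2 * Real.pi)) • volume.restrict (Ioc 0 (2 * Real.pi))).map (velocity t)

lemma integral_velocityLaw {E : Type*} [NormedAddCommGroup E] [NormedSpace ℝ E] (t : Miwa)
    {f : ℝ → E} (hf : Continuous f) [SecondCountableTopologyEither ℝ E] :
    ∫ y, f y ∂(velocityLaw t)
      = (1 / (2 * Real.pi)) • ∫ θ in (0 : ℝ)..(2 * Real.pi), f (velocity t θ) := by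
  rw [velocityLaw, integral_map (continuous_velocity t).measurable.aemeasurable
    hf.aestronglyMeasurable, integral_smul_measure, ENNReal.toReal_ofReal (by positivity),
    intervalIntegral.integral_of_le Real.two_pi_pos.le]

instance (t : Miwa) : IsProbabilityMeasure (velocityLaw t) := by
  refine (Measure.isProbabilityMeasure_map_iff
    (continuous_velocity t).measurable.aemeasurable).2 ⟨?_⟩
  rw [Measure.smul_apply, Measure.restrict_apply MeasurableSet.univ, univ_inter, Real.volume_Ioc,
    smul_eq_mul, ← ENNReal.ofReal_mul (by positivity), sub_zero,
    one_div_mul_cancel Real.two_pi_pos.ne', ENNReal.ofReal_one]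

lemma phase_smul (c : ℝ) (t : Miwa) (θ : ℝ) : phase (c • t) θ = c * phase t θ := by
  unfold phase
  rw [Finsupp.sum_smul_index (by simp)]
  simp only [Finsupp.sum, Finset.mul_sum]
  exact Finset.sum_congr rfl fun n _ => by ring

lemma velocityBound_smul {c : ℝ} (hc : 0 ≤ c) (t : Miwa) :
    velocityBound (c • t) = c * velocityBound t := by
  unfold velocityBound
  rw [Finsupp.sum_smul_index (by simp)]
  simp only [Finsupp.sum, Finset.mul_sum, abs_mul, abs_of_nonneg hc]
  exact Finset.sum_congr rfl fun n _ => by ring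

lemma charFun_rescaledLaw (t : Miwa) (ε s : ℝ) :
    charFun (rescaledLaw t ε) s = 1 / (2 * Real.pi) * ∫ θ in (0 : ℝ)..(2 * Real.pi),
      Complex.exp (((ε⁻¹ * (phase t (θ + ε * s) - phase t θ) : ℝ) : ℂ) * Complex.I) := by
  have h1 := hasSum_integral_atomic (w := fun j : ℤ => besselCoeff (ε⁻¹ • t) j ^ 2)
    (fun _ => sq_nonneg _) (fun j : ℤ => ε * (j : ℝ))
    (f := fun x : ℝ => Complex.exp (s * x * Complex.I))
    (Continuous.stronglyMeasurable (by fun_prop)) (by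
      refine (hasSum_besselCoeff_sq (ε⁻¹ • t)).summable.congr fun j => ?_
      rw [← Complex.ofReal_mul, Complex.norm_exp_ofReal_mul_I, mul_one])
  have h2 := hasSum_besselCoeff_charFun (ε⁻¹ • t) 0 (ε * s)
  rw [charFun_apply_real]
  have e : (fun j : ℤ => (besselCoeff (ε⁻¹ • t) j * besselCoeff (ε⁻¹ • t) (j + 0) : ℂ)
        * Complex.exp (j * ((ε * s : ℝ) : ℂ) * Complex.I))
      = fun j : ℤ => besselCoeff (ε⁻¹ • t) j ^ 2 •
        Complex.exp (s * ((ε * (j : ℝ) : ℝ) : ℂ) * Complex.I) := by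
    funext j
    rw [Complex.real_smul, add_zero]
    push_cast
    rw [sq]
    congr 2
    ring
  rw [e] at h2
  rw [rescaledLaw, h1.unique h2]
  congr 2
  ext θ
  simp only [phase_smul]
  push_cast
  rw [zero_mul, zero_mul, Complex.exp_zero, mul_one]
  congr 1
  ring

lemma tendsto_charFun_rescaledLaw (t : Miwa) (s : ℝ) :
    Tendsto (fun ε => charFun (rescaledLaw t ε) s) (𝓝[>] 0) (𝓝 (charFun (velocityLaw t) s)) := by
  simp only [charFun_rescaledLaw]
  have e : charFun (velocityLaw t) s = 1 / (2 * Real.pi) * ∫ θ in (0 : ℝ)..(2 * Real.pi),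
      Complex.exp (((s * velocity t θ : ℝ) : ℂ) * Complex.I) := by
    rw [charFun_apply_real, integral_velocityLaw t (by fun_prop), Complex.real_smul]
    push_cast; rfl
  rw [e]
  have hc := continuous_phase t
  refine Tendsto.const_mul _ (intervalIntegral.tendsto_integral_filter_of_dominated_convergence
    (fun _ => 1) (Eventually.of_forall fun ε => Continuous.aestronglyMeasurable (by fun_prop))
    (Eventually.of_forall fun ε => ae_of_all _ fun θ _ => by
      rw [Complex.norm_exp_ofReal_mul_I]) (by simp) (ae_of_all _ fun θ _ => ?_))
  have hd : HasDerivAt (fun ε : ℝ => phase t (θ + ε * s)) (s * velocity t θ) 0 := by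
    have h1 : HasDerivAt (fun ε : ℝ => θ + ε * s) s 0 := by
      simpa using ((hasDerivAt_id (0 : ℝ)).mul_const s).const_add θ
    have h2 : HasDerivAt (phase t) (velocity t θ) (θ + 0 * s) := by
      simpa using hasDerivAt_phase t θ
    rw [mul_comm]
    exact HasDerivAt.comp (h₂ := phase t) (h := fun ε : ℝ => θ + ε * s) 0 h2 h1
  have h := hd.tendsto_slope_zero_right
  simp only [zero_add, zero_mul, add_zero, smul_eq_mul] at h
  exact (Continuous.tendsto (by fun_prop : Continuous fun x : ℝ => Complex.exp (x * Complex.I))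
    (s * velocity t θ)).comp h

lemma tendsto_integral_rescaledLaw (t : Miwa) (f : ℝ →ᵇ ℝ) {u : ℕ → ℝ}
    (hu : Tendsto u atTop (𝓝[>] 0)) :
    Tendsto (fun n => ∫ x, f x ∂(rescaledLaw t (u n))) atTop (𝓝 (∫ x, f x ∂(velocityLaw t))) := by
  let μ : ℕ → ProbabilityMeasure ℝ := fun n => ⟨rescaledLaw t (u n), inferInstance⟩
  let μ₀ : ProbabilityMeasure ℝ := ⟨velocityLaw t, inferInstance⟩
  have h : Tendsto μ atTop (𝓝 μ₀) :=
    ProbabilityMeasure.tendsto_iff_tendsto_charFun.2 fun s =>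
      (tendsto_charFun_rescaledLaw t s).comp hu
  exact ProbabilityMeasure.tendsto_iff_forall_integral_tendsto.1 h f

/-- The truncated positive part `min (max (y - x) 0) M`. -/
def truncPosPart (x M : ℝ) (hM : 0 ≤ M) : ℝ →ᵇ ℝ :=
  BoundedContinuousFunction.ofNormedAddCommGroup (fun y => min (max (y - x) 0) M)
    (by fun_prop) M fun y => by
      rw [Real.norm_eq_abs, abs_of_nonneg (le_min (le_max_right _ _) hM)]
      exact min_le_right _ _

lemma summable_besselCoeff_posPart (t : Miwa) (ε x : ℝ) (hx : 0 ≤ x) :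
    Summable fun j : ℤ => besselCoeff t j ^ 2 * max (ε * j - x) 0 := by
  refine ((hasSum_besselCoeff_sq t).summable.add
    ((summable_besselCoeff_sq_mul_sq t).mul_left (ε ^ 2))).of_nonneg_of_le
    (fun j => mul_nonneg (sq_nonneg _) (le_max_right _ _)) fun j => ?_
  have h : max (ε * (j : ℝ) - x) 0 ≤ 1 + ε ^ 2 * (j : ℝ) ^ 2 :=
    max_le (by nlinarith [sq_nonneg (ε * (j : ℝ) - 1)]) (by positivity)
  have := mul_le_mul_of_nonneg_left h (sq_nonneg (besselCoeff t j))
  linarith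

/-- Truncation at the height `M` costs at most `B² / M`, by the second moment bound, uniformly in
`ε`. -/
lemma abs_tsum_posPart_sub_le (t : Miwa) {ε x M : ℝ} (hε : 0 < ε) (hx : 0 ≤ x) (hM : 0 < M) :
    |∑' j : ℤ, besselCoeff (ε⁻¹ • t) j ^ 2 * max (ε * j - x) 0
      - ∫ y, truncPosPart x M hM.le y ∂(rescaledLaw t ε)| ≤ velocityBound t ^ 2 / M := by
  have hnn : ∀ y, 0 ≤ truncPosPart x M hM.le y := fun y => le_min (le_max_right _ _) hM.le
  have hle : ∀ y, truncPosPart x M hM.le y ≤ max (y - x) 0 := fun y => min_le_left _ _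
  have hgap : ∀ y, max (y - x) 0 - truncPosPart x M hM.le y ≤ y ^ 2 / M := by
    intro y
    rw [le_div_iff₀ hM]
    change (max (y - x) 0 - min (max (y - x) 0) M) * M ≤ y ^ 2
    rcases le_total (max (y - x) 0) M with h | h
    · rw [min_eq_left h, sub_self, zero_mul]; positivity
    · rw [min_eq_right h]
      rcases le_total (y - x) 0 with h' | h'
      · rw [max_eq_right h'] at h; linarith
      · rw [max_eq_left h'] at h ⊢
        nlinarith
  have hs := summable_besselCoeff_posPart (ε⁻¹ • t) ε x hx
  have hs' : Summable fun j : ℤ => besselCoeff (ε⁻¹ • t) j ^ 2 *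
      truncPosPart x M hM.le (ε * j) :=
    hs.of_nonneg_of_le (fun j => mul_nonneg (sq_nonneg _) (hnn _))
      fun j => mul_le_mul_of_nonneg_left (hle _) (sq_nonneg _)
  have h1 := hasSum_integral_atomic (w := fun j : ℤ => besselCoeff (ε⁻¹ • t) j ^ 2)
    (fun _ => sq_nonneg _) (fun j : ℤ => ε * (j : ℝ)) (f := truncPosPart x M hM.le)
    (truncPosPart x M hM.le).continuous.stronglyMeasurable
    (by simpa only [Real.norm_eq_abs, abs_of_nonneg (hnn _)] using hs')
  simp only [smul_eq_mul] at h1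
  rw [rescaledLaw, ← h1.tsum_eq, ← hs.tsum_sub hs', abs_of_nonneg (tsum_nonneg fun j => by
    rw [← mul_sub]; exact mul_nonneg (sq_nonneg _) (sub_nonneg.2 (hle _)))]
  have h2 := (summable_besselCoeff_sq_mul_sq (ε⁻¹ • t)).mul_left (ε ^ 2 / M)
  refine ((hs.sub hs').tsum_le_tsum (fun j => ?_) h2).trans ?_
  · rw [← mul_sub]
    refine (mul_le_mul_of_nonneg_left (hgap _) (sq_nonneg _)).trans_eq ?_
    ring
  · rw [tsum_mul_left, div_mul_eq_mul_div]
    gcongr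
    have h3 := tsum_besselCoeff_sq_mul_sq_le (ε⁻¹ • t)
    rw [velocityBound_smul (by positivity), mul_pow, inv_pow] at h3
    calc _ ≤ ε ^ 2 * ((ε ^ 2)⁻¹ * velocityBound t ^ 2) :=
          mul_le_mul_of_nonneg_left h3 (by positivity)
      _ = velocityBound t ^ 2 := by field_simp

/-- The expected positive part of `ε j - x` converges to that of the velocity minus `x`. The tails
are controlled by the second moment. -/
theorem tendsto_tsum_posPart (t : Miwa) {x : ℝ} (hx : 0 ≤ x) :
    Tendsto (fun ε : ℝ => ∑' j : ℤ, besselCoeff (ε⁻¹ • t) j ^ 2 * max (ε * j - x) 0) (𝓝[>] 0)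
      (𝓝 (1 / (2 * Real.pi) * ∫ θ in (0 : ℝ)..(2 * Real.pi), max (velocity t θ - x) 0)) := by
  refine tendsto_of_seq_tendsto fun u hu => ?_
  rw [Metric.tendsto_atTop]
  intro δ hδ
  set B := velocityBound t with hB
  have hB0 : 0 ≤ B := (abs_nonneg _).trans (abs_velocity_le t 0)
  -- For `M ≥ B` the truncation at height `M` does not affect the limit law.
  obtain ⟨M, hM, hBM, hMδ⟩ : ∃ M : ℝ, 0 < M ∧ B ≤ M ∧ B ^ 2 / M < δ / 2 := by
    refine ⟨max (B + 1) (2 * B ^ 2 / δ + 1), lt_max_of_lt_left (by linarith),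
      le_max_of_le_left (by linarith), ?_⟩
    rw [div_lt_iff₀ (lt_max_of_lt_left (by linarith))]
    calc B ^ 2 = δ / 2 * (2 * B ^ 2 / δ) := by field_simp
      _ < δ / 2 * (2 * B ^ 2 / δ + 1) := by linarith
      _ ≤ _ := mul_le_mul_of_nonneg_left (le_max_right _ _) (by linarith)
  have hlim := tendsto_integral_rescaledLaw t (truncPosPart x M hM.le) hu
  rw [integral_velocityLaw t (truncPosPart x M hM.le).continuous, smul_eq_mul] at hlim
  have e : ∀ θ, truncPosPart x M hM.le (velocity t θ) = max (velocity t θ - x) 0 := by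
    intro θ
    refine min_eq_left (max_le ?_ hM.le)
    have := (le_abs_self _).trans (abs_velocity_le t θ)
    linarith
  simp only [e] at hlim
  obtain ⟨N, hN⟩ := Metric.tendsto_atTop.1 hlim (δ / 2) (by linarith)
  obtain ⟨N', hN'⟩ := eventually_atTop.1 (hu.eventually self_mem_nhdsWithin)
  refine ⟨max N N', fun n hn => ?_⟩
  have h1 := hN n (le_of_max_le_left hn)
  have h2 := abs_tsum_posPart_sub_le t (hN' n (le_of_max_le_right hn)) hx hM
  rw [← Real.dist_eq] at h2
  rw [Function.comp_apply]
  linarith [dist_triangle (∑' j : ℤ, besselCoeff ((u n)⁻¹ • t) j ^ 2 * max (u n * j - x) 0)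
    (∫ y, truncPosPart x M hM.le y ∂(rescaledLaw t (u n)))
    (1 / (2 * Real.pi) * ∫ θ in (0 : ℝ)..(2 * Real.pi), max (velocity t θ - x) 0)]

/-! ### Strict partitions as even states -/

lemma prod_fermion_ket (l : List ℕ) (S : Finset ℕ) (hl : l.Pairwise (· > ·))
    (hS : ∀ a ∈ l, ∀ x ∈ S, x < a) :
    ((l.map fun a : ℕ => fermion a).prod) (ket S) = ket (l.toFinset ∪ S) := by
  induction l with
  | nil => simp
  | cons a l ih =>
    rw [List.pairwise_cons] at hl
    rw [List.map_cons, List.prod_cons, Module.End.mul_apply,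
      ih hl.2 fun b hb => hS b (List.mem_cons_of_mem _ hb), ← ket_insert_of_max,
      List.toFinset_cons, Finset.insert_union]
    intro x hx
    rw [Finset.mem_union, List.mem_toFinset] at hx
    rcases hx with hx | hx
    · exact hl.1 x hx
    · exact hS a List.mem_cons_self x hx

/-- The even set of occupied sites of a strict partition: its parts, with `0` adjoined if their
number is odd. -/
def StrictPartition.evenSet (p : StrictPartition) : Finset ℕ :=
  if Even p.length then p.parts else insert 0 p.parts

lemma StrictPartition.zero_notMem (p : StrictPartition) : 0 ∉ p.parts :=
  fun h => lt_irrefl 0 (p.pos 0 h)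

lemma StrictPartition.erase_evenSet (p : StrictPartition) : p.evenSet.erase 0 = p.parts := by
  unfold StrictPartition.evenSet
  split_ifs
  · exact Finset.erase_eq_of_notMem p.zero_notMem
  · exact Finset.erase_insert p.zero_notMem

lemma StrictPartition.evenSet_injective : Function.Injective StrictPartition.evenSet := by
  intro p q h
  ext1
  rw [← p.erase_evenSet, ← q.erase_evenSet, h]

instance : Countable StrictPartition := StrictPartition.evenSet_injective.countable

lemma StrictPartition.mem_evenSet (p : StrictPartition) {a : ℕ} (ha : a ≠ 0) :
    a ∈ p.evenSet ↔ a ∈ p.parts := by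
  rw [← p.erase_evenSet, Finset.mem_erase]; simp [ha]

lemma StrictPartition.mem_range_evenSet {S : Finset ℕ} (hS : Even S.card) :
    S ∈ range StrictPartition.evenSet := by
  refine ⟨⟨S.erase 0, fun a ha => Nat.pos_of_ne_zero (Finset.ne_of_mem_erase ha)⟩, ?_⟩
  unfold StrictPartition.evenSet StrictPartition.length
  by_cases h0 : 0 ∈ S
  · have h1 := Finset.card_erase_add_one h0
    rw [if_neg, Finset.insert_erase h0]
    rw [← h1, Nat.even_add_one] at hS
    exact hS
  · simp only [Finset.erase_eq_of_notMem h0]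
    rw [if_pos hS]

/-- The state of a strict partition is a multiple of a basis vector, as its parts are in decreasing
order. -/
lemma partitionState_eq (p : StrictPartition) : partitionState p =
    (if Even p.length then (1 : ℝ) else √2) • ket p.evenSet := by
  have hpw : (p.parts.sort (fun a b => a ≥ b)).Pairwise (· > ·) := by
    have h1 := Finset.pairwise_sort p.parts (fun a b => a ≥ b)
    have h2 := Finset.sort_nodup p.parts (fun a b => a ≥ b)
    exact (h1.and h2).imp fun h => lt_of_le_of_ne h.1 h.2.symm
  unfold partitionState parityState StrictPartition.evenSet
  split_ifs with h
  · rw [vacuum, prod_fermion_ket _ _ hpw (by simp), Finset.sort_toFinset, Finset.union_empty,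
      one_smul]
  · have h0 : fermion 0 vacuum = ket {0} := by
      have := ket_insert_of_max (a := 0) (S := ∅) (by simp)
      rw [vacuum, ← Nat.cast_zero, ← this]; rfl
    rw [h0, map_smul, prod_fermion_ket _ _ hpw, Finset.sort_toFinset, Finset.union_comm]
    · rfl
    · intro a ha x hx
      rw [Finset.mem_singleton] at hx
      rw [Finset.mem_sort] at ha
      exact hx ▸ p.pos a ha

/-- The factor `√2` of the odd states makes up for the squared length `1/2` of the kets containing
`0`. -/
lemma schurP_mul_schurQ (p : StrictPartition) (t : Miwa) :
    schurP p t * schurQ p t = ketWeight ((2 : ℝ) • t) p.evenSet := by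
  have h2 : (√2 ^ p.length) ^ 2 = 2 ^ p.length := by
    rw [← pow_mul, mul_comm, pow_mul, Real.sq_sqrt (by norm_num)]
  have h3 : (2 : ℝ) ^ p.length ≠ 0 := by positivity
  have h1 : schurP p t * schurQ p t = expVacuum ((2 : ℝ) • t) (partitionState p) ^ 2 := by
    unfold schurP schurQ
    rw [div_mul_eq_mul_div, ← sq, mul_pow, h2, mul_div_cancel_left₀ _ h3]
  rw [h1, partitionState_eq, ← inner_coherentState, map_smul, inner_smul_right,
    inner_coherentState, mul_pow, ketWeight, ketNormSq]
  unfold StrictPartition.evenSet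
  split_ifs with h h' h'
  · exact absurd h' p.zero_notMem
  · simp
  · rw [Real.sq_sqrt (by norm_num)]; ring
  · exact absurd (Finset.mem_insert_self _ _) h'

lemma partitionFunction_eq (t : Miwa) :
    partitionFunction t = Real.exp (heisenbergConst ((2 : ℝ) • t)) := by
  unfold partitionFunction heisenbergConst
  rw [Finsupp.sum_smul_index (by simp)]
  congr 1
  exact Finset.sum_congr rfl fun n _ => by ring

/-- The probability of a strict partition. -/
def probability (t : Miwa) (p : StrictPartition) : ℝ :=
  ketWeight ((2 : ℝ) • t) p.evenSet / Real.exp (heisenbergConst ((2 : ℝ) • t))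

lemma probability_nonneg (t : Miwa) (p : StrictPartition) : 0 ≤ probability t p :=
  div_nonneg (ketWeight_nonneg _ _) (Real.exp_pos _).le

lemma shiftedSchurMeasure_eq (t : Miwa) : shiftedSchurMeasure t = atomic (probability t) id := by
  unfold shiftedSchurMeasure atomic probability
  simp only [schurP_mul_schurQ, partitionFunction_eq, id]

/-- Sums over strict partitions of functions of the even set are sums over all finite sets of
natural numbers, since the coherent state is even. -/
lemma hasSum_probability_mul (t : Miwa) {f : Finset ℕ → ℝ} {s : ℝ}
    (h : HasSum (fun S => ketWeight ((2 : ℝ) • t) S * f S) s) :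
    HasSum (fun p : StrictPartition => probability t p * f p.evenSet)
      (s / Real.exp (heisenbergConst ((2 : ℝ) • t))) := by
  have h1 := (StrictPartition.evenSet_injective.hasSum_iff fun S hS => by
    have : Odd S.card := by
      rw [← Nat.not_even_iff_odd]; exact fun h => hS (StrictPartition.mem_range_evenSet h)
    rw [ketWeight_of_odd _ this, zero_mul]).2 h
  have h2 := h1.div_const (Real.exp (heisenbergConst ((2 : ℝ) • t)))
  have e : (fun p : StrictPartition => probability t p * f p.evenSet) = fun p =>
      ((fun S => ketWeight ((2 : ℝ) • t) S * f S) ∘ StrictPartition.evenSet) p /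
      Real.exp (heisenbergConst ((2 : ℝ) • t)) := by
    funext p
    simp only [probability, Function.comp]
    ring
  rw [e]
  exact h2

lemma hasSum_probability (t : Miwa) : HasSum (probability t) 1 := by
  have h := hasSum_probability_mul t (f := fun _ => 1) (s := _)
    (by simpa using hasSum_ketWeight ((2 : ℝ) • t))
  rw [div_self (Real.exp_pos _).ne'] at h
  simpa using h

instance (t : Miwa) : IsProbabilityMeasure (shiftedSchurMeasure t) := by
  rw [shiftedSchurMeasure_eq]
  exact isProbabilityMeasure_atomic (probability_nonneg t) _ (hasSum_probability t)

/-! ### One-point correlation functions -/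

/-- Functions on strict partitions are strongly measurable. -/
lemma stronglyMeasurable_strictPartition (f : StrictPartition → ℝ) : StronglyMeasurable f :=
  (measurable_from_top : Measurable f).stronglyMeasurable

lemma hasSum_probability_mem (t : Miwa) (a : ℕ) :
    HasSum (fun p : StrictPartition => probability t p * (if a ∈ p.parts then 1 else 0))
      (rho {a} t) := by
  have hs : Summable fun p : StrictPartition =>
      probability t p * ‖({p : StrictPartition | {a} ⊆ p.parts}.indicator 1 p : ℝ)‖ := by
    refine (hasSum_probability t).summable.of_nonneg_of_le
      (fun p => mul_nonneg (probability_nonneg t p) (norm_nonneg _)) fun p => ?_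
    refine mul_le_of_le_one_right (probability_nonneg t p) ?_
    rw [Set.indicator_apply]
    split_ifs <;> simp
  have h := hasSum_integral_atomic (probability_nonneg t) id
    (stronglyMeasurable_strictPartition _) hs
  rw [← shiftedSchurMeasure_eq, integral_indicator_one MeasurableSpace.measurableSet_top] at h
  have e : (fun p : StrictPartition => probability t p * (if a ∈ p.parts then 1 else 0))
      = fun p => probability t p •
        ({p : StrictPartition | {a} ⊆ p.parts}.indicator 1 (id p) : ℝ) := by
    funext p
    simp [Set.indicator_apply]
  rw [e]
  exact h

/-- The one-point function of the shifted Schur measure: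
`ρ(a) = J_a² / 2 + ∑_{j > a} J_j²`. -/
theorem hasSum_rho (t : Miwa) {a : ℕ} (ha : a ≠ 0) :
    HasSum (fun j : ℤ => besselCoeff ((2 : ℝ) • t) j ^ 2 * vacuumOccupation (j - a))
      (rho {a} t) := by
  have hexp := (Real.exp_pos (heisenbergConst ((2 : ℝ) • t))).ne'
  have h1 := hasSum_norm_sq_bogoliubov (inner_bogoliubov_add
    (inner_fieldState_add ((2 : ℝ) • t)) (hasSum_dressedState _) (hasSum_dressedState_alternate _)
    (hasSum_besselCoeff_orthonormal _)) (fun b hb => dressedState_of_pos _ hb)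
    (hasSum_fieldState_dressed _) a
  have h2 := hasSum_probability_mul t (f := fun S => if a ∈ S then 1 else 0)
    (by simpa using hasSum_ketWeight_mem ((2 : ℝ) • t) ha)
  simp only [StrictPartition.mem_evenSet _ ha] at h2
  rw [(hasSum_probability_mem t a).unique h2]
  have h3 := h1.div_const (Real.exp (heisenbergConst ((2 : ℝ) • t)))
  simpa only [mul_div_cancel_left₀ _ hexp] using h3

/-- The sum of `vacuumOccupation (d - 1 - k)` over `k ≥ 0`. -/
def tailOccupation (d : ℤ) : ℝ := if 0 < d then d - 1 / 2 else 0

lemma tailOccupation_nonneg (d : ℤ) : 0 ≤ tailOccupation d := by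
  unfold tailOccupation
  split_ifs with h
  · have : (1 : ℝ) ≤ d := by exact_mod_cast h
    linarith
  · exact le_rfl

lemma hasSum_vacuumOccupation (d : ℤ) :
    HasSum (fun k : ℕ => vacuumOccupation (d - (k + 1))) (tailOccupation d) := by
  unfold tailOccupation
  split_ifs with h
  · obtain ⟨n, rfl⟩ : ∃ n : ℕ, d = n + 1 := ⟨(d - 1).toNat, by omega⟩
    have h1 : ∀ k ∉ Finset.range (n + 1), vacuumOccupation ((n : ℤ) + 1 - (k + 1)) = 0 := by
      intro k hk
      rw [Finset.mem_range] at hk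
      rw [vacuumOccupation, if_neg (by omega), if_neg (by omega)]
    have h3 := hasSum_sum_of_ne_finset_zero (L := SummationFilter.unconditional ℕ) h1
    convert h3 using 1
    have h2 : ∀ k ∈ Finset.range n, vacuumOccupation ((n : ℤ) + 1 - (k + 1)) = 1 := by
      intro k hk
      rw [Finset.mem_range] at hk
      rw [vacuumOccupation, if_pos (by omega)]
    rw [Finset.sum_range_succ, Finset.sum_congr rfl h2, sub_self]
    simp [vacuumOccupation]
    ring
  · convert hasSum_zero with k
    rw [vacuumOccupation, if_neg (by omega), if_neg (by omega)]

lemma vacuumOccupation_nonneg (j : ℤ) : 0 ≤ vacuumOccupation j := by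
  unfold vacuumOccupation; split_ifs <;> norm_num

/-- Exchange of the order of summation for a nonnegative double series. -/
lemma hasSum_comm_of_nonneg {α β : Type*} {f : α → β → ℝ} {g : α → ℝ} {h : β → ℝ} {s : ℝ}
    (hf : ∀ a b, 0 ≤ f a b) (hg : ∀ a, HasSum (f a) (g a)) (hs : HasSum g s)
    (hh : ∀ b, HasSum (fun a => f a b) (h b)) : HasSum h s := by
  have h1 : Summable fun p : α × β => f p.1 p.2 := by
    refine (summable_prod_of_nonneg fun p => hf p.1 p.2).2 ⟨fun a => (hg a).summable, ?_⟩
    simpa only [(hg _).tsum_eq] using hs.summable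
  have h2 : ∑' p : α × β, f p.1 p.2 = s := (h1.hasSum.prod_fiberwise hg).unique hs
  have h3 := (Equiv.prodComm β α).hasSum_iff.2 h1.hasSum
  rw [h2] at h3
  exact h3.prod_fiberwise hh

lemma summable_tailOccupation (t : Miwa) (m : ℕ) :
    Summable fun j : ℤ => besselCoeff t j ^ 2 * tailOccupation (j - m) := by
  refine (summable_besselCoeff_posPart t 1 m m.cast_nonneg).of_nonneg_of_le
    (fun j => mul_nonneg (sq_nonneg _) (tailOccupation_nonneg _)) fun j =>
    mul_le_mul_of_nonneg_left ?_ (sq_nonneg _)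
  unfold tailOccupation
  split_ifs
  · refine le_max_of_le_left ?_
    push_cast; linarith
  · exact le_max_right _ _

/-- The expected number of parts larger than `m`, as a moment of the weights `J_j²`. -/
theorem hasSum_rho_tail (t : Miwa) (m : ℕ) :
    HasSum (fun k : ℕ => rho {m + (k + 1)} t)
      (∑' j : ℤ, besselCoeff ((2 : ℝ) • t) j ^ 2 * tailOccupation (j - m)) := by
  refine hasSum_comm_of_nonneg
    (f := fun (j : ℤ) (k : ℕ) =>
      besselCoeff ((2 : ℝ) • t) j ^ 2 * vacuumOccupation (j - m - (k + 1)))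
    (fun j k => mul_nonneg (sq_nonneg _) (vacuumOccupation_nonneg _))
    (fun j => (hasSum_vacuumOccupation _).mul_left _) (summable_tailOccupation _ m).hasSum
    fun k => ?_
  convert hasSum_rho t (a := m + (k + 1)) (by omega) using 4 with j
  push_cast; ring

/-- The expected number of parts larger than `m` is the sum of the one-point functions. -/
lemma hasSum_probability_count (t : Miwa) (m : ℕ) :
    HasSum (fun p : StrictPartition =>
      probability t p * ((p.parts.filter fun a => m < a).card : ℝ))
      (∑' k : ℕ, rho {m + (k + 1)} t) := by
  refine hasSum_comm_of_nonneg
    (f := fun (k : ℕ) (p : StrictPartition) =>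
      probability t p * (if m + (k + 1) ∈ p.parts then 1 else 0))
    (fun k p => mul_nonneg (probability_nonneg t p) (by split_ifs <;> norm_num))
    (fun k => hasSum_probability_mem t _) (hasSum_rho_tail t m).summable.hasSum
    fun p => HasSum.mul_left _ ?_
  have hinj : Function.Injective fun k : ℕ => m + (k + 1) := fun a b h => by
    simp only at h; omega
  have h1 : HasSum (fun a : ℕ => if a ∈ p.parts.filter (fun a => m < a) then (1 : ℝ) else 0)
      ((p.parts.filter fun a => m < a).card : ℝ) := by
    have h3 := hasSum_sum_of_ne_finset_zero (L := SummationFilter.unconditional ℕ)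
      (s := p.parts.filter fun a => m < a)
      (f := fun a => if a ∈ p.parts.filter (fun a => m < a) then (1 : ℝ) else 0)
      fun a ha => if_neg ha
    rw [Finset.sum_congr rfl fun a ha => if_pos ha] at h3
    simpa only [Finset.sum_const, nsmul_eq_mul, mul_one] using h3
  have h2 := (hinj.hasSum_iff (f := fun a : ℕ =>
    if a ∈ p.parts.filter (fun a => m < a) then (1 : ℝ) else 0) (by
      intro a ha
      rw [if_neg]
      intro h
      rw [Finset.mem_filter] at h
      exact ha ⟨a - m - 1, by simp only; omega⟩)).2 h1
  have e : (fun k : ℕ => if m + (k + 1) ∈ p.parts then (1 : ℝ) else 0) = fun k : ℕ =>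
      if m + (k + 1) ∈ p.parts.filter (fun a => m < a) then (1 : ℝ) else 0 := by
    funext k
    refine if_congr ?_ rfl rfl
    rw [Finset.mem_filter]
    exact ⟨fun h => ⟨h, by omega⟩, fun h => h.1⟩
  rw [e]
  exact h2

lemma profile_eq (p : StrictPartition) {ε : ℝ} (hε : 0 < ε) (m : ℕ) :
    profile p ε (m * ε) = m * ε + 2 * ε * ((p.parts.filter fun a => m < a).card : ℝ) := by
  unfold profile
  congr 5
  ext a
  rw [mul_lt_mul_iff_left₀ hε, Nat.cast_lt]

lemma integrable_profile (t : Miwa) {ε : ℝ} (hε : 0 < ε) (m : ℕ) :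
    Integrable (fun p => profile p ε (m * ε)) (shiftedSchurMeasure t) ∧
    ∫ p, profile p ε (m * ε) ∂(shiftedSchurMeasure t)
      = m * ε + 2 * ε * ∑' k : ℕ, rho {m + (k + 1)} t := by
  have h : HasSum (fun p => probability t p * profile p ε (m * ε))
      (m * ε + 2 * ε * ∑' k : ℕ, rho {m + (k + 1)} t) := by
    have h1 := ((hasSum_probability t).mul_right (m * ε)).add
      ((hasSum_probability_count t m).mul_left (2 * ε))
    rw [one_mul] at h1
    have e : (fun p => probability t p * profile p ε (m * ε)) = fun p =>
        probability t p * (m * ε) + 2 * ε *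
          (probability t p * ((p.parts.filter fun a => m < a).card : ℝ)) := by
      funext p
      rw [profile_eq p hε]; ring
    rw [e]
    exact h1
  have hnn : ∀ p, 0 ≤ profile p ε (m * ε) := fun p => by
    rw [profile_eq p hε]; positivity
  have hs : Summable fun p => probability t p * ‖profile p ε (m * ε)‖ := by
    simpa only [Real.norm_eq_abs, abs_of_nonneg (hnn _)] using h.summable
  have hm := stronglyMeasurable_strictPartition fun p => profile p ε (m * ε)
  have h2 := hasSum_integral_atomic (f := fun p => profile p ε (m * ε)) (probability_nonneg t) id
    hm hs
  simp only [smul_eq_mul, id] at h2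
  rw [shiftedSchurMeasure_eq]
  exact ⟨integrable_atomic (f := fun p => profile p ε (m * ε)) (probability_nonneg t) id hm hs,
    h2.unique h⟩

/-! ### The dispersion relation -/

lemma velocity_two_smul (t : Miwa) (θ : ℝ) : velocity ((2 : ℝ) • t) θ = dispersion t θ := by
  unfold velocity dispersion
  rw [Finsupp.sum_smul_index (by simp)]
  simp only [Finsupp.sum, Finset.mul_sum]
  exact Finset.sum_congr rfl fun n _ => by ring

lemma continuous_dispersion (t : Miwa) : Continuous (dispersion t) := by
  unfold dispersion Finsupp.sum; fun_prop

lemma hasDerivAt_dispersion (t : Miwa) (θ : ℝ) : HasDerivAt (dispersion t)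
    (-(4 * t.sum fun n c => (n : ℝ) ^ 2 * c * Real.sin (n * θ))) θ := by
  unfold dispersion Finsupp.sum
  rw [← mul_neg, ← Finset.sum_neg_distrib]
  refine HasDerivAt.const_mul _ (HasDerivAt.fun_sum fun n _ => ?_)
  have h : HasDerivAt (fun θ : ℝ => ((n : ℕ) : ℝ) * θ) (n : ℕ) θ := by
    simpa using (hasDerivAt_id θ).const_mul ((n : ℕ) : ℝ)
  exact (h.cos.const_mul (((n : ℕ) : ℝ) * t n)).congr_deriv (by ring)

lemma dispersion_zero (t : Miwa) : dispersion t 0 = edge t := by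
  simp [dispersion, edge]

lemma dispersion_pi (t : Miwa) : dispersion t Real.pi = -edge t := by
  unfold dispersion edge Finsupp.sum
  rw [← mul_neg, ← Finset.sum_neg_distrib]
  congr 1
  refine Finset.sum_congr rfl fun n _ => ?_
  beta_reduce
  rw [Real.cos_nat_mul_pi, n.2.neg_one_pow]; ring

lemma dispersion_two_pi_sub (t : Miwa) (θ : ℝ) :
    dispersion t (2 * Real.pi - θ) = dispersion t θ := by
  unfold dispersion Finsupp.sum
  congr 1
  refine Finset.sum_congr rfl fun n _ => ?_
  beta_reduce
  rw [mul_sub, Real.cos_nat_mul_two_pi_sub]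

lemma NonDegenerate.strictAntiOn {t : Miwa} (ht : NonDegenerate t) :
    StrictAntiOn (dispersion t) (Icc 0 Real.pi) := by
  refine strictAntiOn_of_deriv_neg (convex_Icc _ _) (continuous_dispersion t).continuousOn ?_
  intro θ hθ
  rw [interior_Icc] at hθ
  rw [(hasDerivAt_dispersion t θ).deriv]
  exact neg_neg_of_pos (ht θ hθ)

lemma NonDegenerate.existsUnique {t : Miwa} (ht : NonDegenerate t) {x : ℝ}
    (hx : x ∈ Icc (-edge t) (edge t)) :
    ∃ θ ∈ Icc 0 Real.pi, dispersion t θ = x ∧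
      ∀ θ' ∈ Icc 0 Real.pi, dispersion t θ' = x → θ' = θ := by
  have h := intermediate_value_Icc' Real.pi_pos.le (continuous_dispersion t).continuousOn
  rw [dispersion_zero, dispersion_pi] at h
  obtain ⟨θ, hθ, rfl⟩ := h hx
  exact ⟨θ, hθ, rfl, fun θ' hθ' h => ht.strictAntiOn.injOn hθ' hθ h⟩

lemma integral_posPart_dispersion (t : Miwa) (x : ℝ) :
    ∫ θ in (0 : ℝ)..(2 * Real.pi), max (dispersion t θ - x) 0
      = 2 * ∫ θ in (0 : ℝ)..Real.pi, max (dispersion t θ - x) 0 := by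
  have hc := continuous_dispersion t
  have hi : ∀ a b : ℝ, IntervalIntegrable (fun θ => max (dispersion t θ - x) 0) volume a b :=
    fun a b => Continuous.intervalIntegrable (by fun_prop) a b
  rw [← intervalIntegral.integral_add_adjacent_intervals (hi 0 Real.pi) (hi Real.pi _)]
  have h := intervalIntegral.integral_comp_sub_left (a := 0) (b := Real.pi)
    (fun θ => max (dispersion t θ - x) 0) (2 * Real.pi)
  simp only [dispersion_two_pi_sub] at h
  rw [show 2 * Real.pi - Real.pi = Real.pi by ring, sub_zero] at h
  linarith

lemma integral_posPart_of_le_edge {t : Miwa} (ht : NonDegenerate t) {x θ₀ : ℝ}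
    (hθ₀ : θ₀ ∈ Icc 0 Real.pi) (hx : dispersion t θ₀ = x) :
    ∫ θ in (0 : ℝ)..Real.pi, max (dispersion t θ - x) 0
      = ∫ θ in (0 : ℝ)..θ₀, (dispersion t θ - x) := by
  have hc := continuous_dispersion t
  have hi : ∀ a b : ℝ, IntervalIntegrable (fun θ => max (dispersion t θ - x) 0) volume a b :=
    fun a b => Continuous.intervalIntegrable (by fun_prop) a b
  have hanti := ht.strictAntiOn.antitoneOn
  rw [← intervalIntegral.integral_add_adjacent_intervals (hi 0 θ₀) (hi θ₀ _)]
  have h1 : ∫ θ in θ₀..Real.pi, max (dispersion t θ - x) 0 = ∫ θ in θ₀..Real.pi, (0 : ℝ) := by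
    refine intervalIntegral.integral_congr fun θ hθ => ?_
    rw [uIcc_of_le hθ₀.2] at hθ
    have := hanti hθ₀ ⟨hθ₀.1.trans hθ.1, hθ.2⟩ hθ.1
    exact max_eq_right (by linarith)
  rw [h1, intervalIntegral.integral_zero, add_zero]
  refine intervalIntegral.integral_congr fun θ hθ => ?_
  rw [uIcc_of_le hθ₀.1] at hθ
  have := hanti ⟨hθ.1, hθ.2.trans hθ₀.2⟩ hθ₀ hθ.2
  exact max_eq_left (by linarith)

lemma integral_posPart_of_edge_le {t : Miwa} (ht : NonDegenerate t) {x : ℝ} (hx : edge t ≤ x) :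
    ∫ θ in (0 : ℝ)..Real.pi, max (dispersion t θ - x) 0 = 0 := by
  have h1 : ∫ θ in (0 : ℝ)..Real.pi, max (dispersion t θ - x) 0
      = ∫ θ in (0 : ℝ)..Real.pi, (0 : ℝ) := by
    refine intervalIntegral.integral_congr fun θ hθ => ?_
    rw [uIcc_of_le Real.pi_pos.le] at hθ
    have := ht.strictAntiOn.antitoneOn ⟨le_rfl, Real.pi_pos.le⟩ hθ hθ.1
    rw [dispersion_zero] at this
    exact max_eq_right (by linarith)
  rw [h1, intervalIntegral.integral_zero]

/-! ### The limit shape -/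

lemma exists_of_mem_meshSizes {x ε : ℝ} (h : ε ∈ meshSizes x) :
    0 < ε ∧ x = ⌊x / ε⌋₊ * ε := by
  obtain ⟨hε, m, rfl⟩ := h
  refine ⟨hε, ?_⟩
  rw [mul_div_cancel_right₀ _ hε.ne', Nat.floor_natCast]

lemma abs_tailOccupation_sub_le {ε : ℝ} (hε : 0 < ε) (j : ℤ) (m : ℕ) :
    |2 * ε * tailOccupation (j - m) - 2 * max (ε * j - m * ε) 0| ≤ ε := by
  unfold tailOccupation
  have e : ε * (j : ℝ) - m * ε = ε * ((j - m : ℤ) : ℝ) := by push_cast; ring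
  rw [e]
  split_ifs with h
  · have h1 : (0 : ℝ) ≤ ((j - m : ℤ) : ℝ) := by exact_mod_cast h.le
    rw [max_eq_left (mul_nonneg hε.le h1), abs_le]
    constructor <;> nlinarith
  · have h1 : ((j - m : ℤ) : ℝ) ≤ 0 := by exact_mod_cast not_lt.1 h
    rw [max_eq_right (mul_nonpos_of_nonneg_of_nonpos hε.le h1)]
    simpa using hε.le

/-- The half-integer shift in the formula for the sum of the correlation functions is negligible,
since the weights `J_j²` sum to one. -/
lemma abs_rho_sum_sub_le (t : Miwa) {x ε : ℝ} (hx : 0 ≤ x) (h : ε ∈ meshSizes x) :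
    |2 * ε * ∑' k : ℕ, rho {⌊x / ε⌋₊ + (k + 1)} (ε⁻¹ • t)
      - 2 * ∑' j : ℤ, besselCoeff (ε⁻¹ • (2 : ℝ) • t) j ^ 2 * max (ε * j - x) 0| ≤ ε := by
  obtain ⟨hε, hm⟩ := exists_of_mem_meshSizes h
  set m := ⌊x / ε⌋₊
  rw [(hasSum_rho_tail _ m).tsum_eq, smul_comm (2 : ℝ) ε⁻¹ t]
  have h1 := (summable_tailOccupation (ε⁻¹ • (2 : ℝ) • t) m).hasSum.mul_left (2 * ε)
  have h2 := (summable_besselCoeff_posPart (ε⁻¹ • (2 : ℝ) • t) ε x hx).hasSum.mul_left 2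
  have h3 := (hasSum_besselCoeff_sq (ε⁻¹ • (2 : ℝ) • t)).mul_left ε
  rw [← (h1.sub h2).tsum_eq]
  rw [mul_one] at h3
  rw [← Real.norm_eq_abs]
  refine tsum_of_norm_bounded h3 fun j => ?_
  have h4 := mul_le_mul_of_nonneg_right (abs_tailOccupation_sub_le hε j m)
    (sq_nonneg (besselCoeff (ε⁻¹ • (2 : ℝ) • t) j))
  rw [← hm] at h4
  refine le_trans (le_of_eq ?_) h4
  rw [Real.norm_eq_abs, ← abs_of_nonneg (sq_nonneg (besselCoeff (ε⁻¹ • (2 : ℝ) • t) j)),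
    ← abs_mul, abs_of_nonneg (sq_nonneg (besselCoeff (ε⁻¹ • (2 : ℝ) • t) j))]
  congr 1
  ring

theorem tendsto_rho_sum (t : Miwa) {x : ℝ} (hx : 0 ≤ x) :
    Tendsto (fun ε : ℝ => 2 * ε * ∑' k : ℕ, rho {⌊x / ε⌋₊ + (k + 1)} (ε⁻¹ • t))
      (𝓝[meshSizes x] 0)
      (𝓝 (2 / Real.pi * ∫ θ in (0 : ℝ)..Real.pi, max (dispersion t θ - x) 0)) := by
  have hle : 𝓝[meshSizes x] (0 : ℝ) ≤ 𝓝[>] 0 := nhdsWithin_mono _ fun ε hε => hε.1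
  have h1 := ((tendsto_tsum_posPart ((2 : ℝ) • t) hx).mono_left hle).const_mul 2
  simp only [velocity_two_smul, integral_posPart_dispersion] at h1
  have h2 : Tendsto (fun ε : ℝ => 2 * ε * ∑' k : ℕ, rho {⌊x / ε⌋₊ + (k + 1)} (ε⁻¹ • t)
      - 2 * ∑' j : ℤ, besselCoeff (ε⁻¹ • (2 : ℝ) • t) j ^ 2 * max (ε * j - x) 0)
      (𝓝[meshSizes x] 0) (𝓝 0) := by
    refine squeeze_zero_norm' ?_ (tendsto_id.mono_left nhdsWithin_le_nhds)
    filter_upwards [self_mem_nhdsWithin] with ε hε using abs_rho_sum_sub_le t hx hε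
  have h3 := h2.add h1
  simp only [sub_add_cancel, zero_add] at h3
  convert h3 using 2
  field_simp

end

end ShiftedSchur

theorem theorem4p1 (t : Miwa) (ht : NonDegenerate t) :
    (∀ ε : ℝ, 0 < ε → IsProbabilityMeasure (shiftedSchurMeasure (ε⁻¹ • t))) ∧
    ∃ χ : ℝ → ℝ,
      (∀ x ∈ Icc (-edge t) (edge t), χ x ∈ Icc 0 Real.pi ∧ dispersion t (χ x) = x ∧
        ∀ θ ∈ Icc 0 Real.pi, dispersion t θ = x → θ = χ x) ∧
      ∀ x : ℝ, 0 ≤ x →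
        (∀ ε ∈ meshSizes x,
          Summable (fun k : ℕ => rho {⌊x / ε⌋₊ + (k + 1)} (ε⁻¹ • t)) ∧
          Integrable (fun p => profile p ε x) (shiftedSchurMeasure (ε⁻¹ • t))) ∧
        (x ≤ edge t →
          Tendsto (fun ε : ℝ => 2 * ε * ∑' k : ℕ, rho {⌊x / ε⌋₊ + (k + 1)} (ε⁻¹ • t))
            (𝓝[meshSizes x] 0)
            (𝓝 (2 / Real.pi * ∫ θ in (0 : ℝ)..(χ x), (dispersion t θ - x))) ∧
          Tendsto (fun ε : ℝ => ∫ p, profile p ε x ∂(shiftedSchurMeasure (ε⁻¹ • t)))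
            (𝓝[meshSizes x] 0)
            (𝓝 (x + 2 / Real.pi * ∫ θ in (0 : ℝ)..(χ x), (dispersion t θ - x)))) ∧
        (edge t ≤ x →
          Tendsto (fun ε : ℝ => 2 * ε * ∑' k : ℕ, rho {⌊x / ε⌋₊ + (k + 1)} (ε⁻¹ • t))
            (𝓝[meshSizes x] 0) (𝓝 0) ∧
          Tendsto (fun ε : ℝ => ∫ p, profile p ε x ∂(shiftedSchurMeasure (ε⁻¹ • t)))
            (𝓝[meshSizes x] 0) (𝓝 x)) := by
  have hprofile : ∀ x : ℝ, 0 ≤ x → ∀ ε ∈ meshSizes x,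
      Integrable (fun p => profile p ε x) (shiftedSchurMeasure (ε⁻¹ • t)) ∧
      ∫ p, profile p ε x ∂(shiftedSchurMeasure (ε⁻¹ • t))
        = x + 2 * ε * ∑' k : ℕ, rho {⌊x / ε⌋₊ + (k + 1)} (ε⁻¹ • t) := by
    intro x _ ε hε
    obtain ⟨hpos, hm⟩ := exists_of_mem_meshSizes hε
    have h := integrable_profile (ε⁻¹ • t) hpos ⌊x / ε⌋₊
    rwa [← hm] at h
  have hlim : ∀ x : ℝ, 0 ≤ x → ∀ L : ℝ,
      2 / Real.pi * ∫ θ in (0 : ℝ)..Real.pi, max (dispersion t θ - x) 0 = L →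
      Tendsto (fun ε : ℝ => 2 * ε * ∑' k : ℕ, rho {⌊x / ε⌋₊ + (k + 1)} (ε⁻¹ • t))
        (𝓝[meshSizes x] 0) (𝓝 L) ∧
      Tendsto (fun ε : ℝ => ∫ p, profile p ε x ∂(shiftedSchurMeasure (ε⁻¹ • t)))
        (𝓝[meshSizes x] 0) (𝓝 (x + L)) := by
    rintro x hx L rfl
    have h := tendsto_rho_sum t hx
    refine ⟨h, (h.const_add x).congr' ?_⟩
    filter_upwards [self_mem_nhdsWithin] with ε hε using (hprofile x hx ε hε).2.symm
  choose! χ hχ using fun (x : ℝ) (hx : x ∈ Icc (-edge t) (edge t)) => ht.existsUnique hx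
  refine ⟨fun ε _ => inferInstance, χ, hχ, fun x hx => ⟨fun ε hε => ⟨?_, (hprofile x hx ε hε).1⟩,
    fun hxe => ?_, fun hxe => ?_⟩⟩
  · exact (hasSum_rho_tail _ _).summable
  · obtain ⟨h1, h2, -⟩ := hχ x ⟨by linarith, hxe⟩
    exact hlim x hx _ (by rw [integral_posPart_of_le_edge ht h1 h2])
  · have h := hlim x hx 0 (by rw [integral_posPart_of_edge_le ht hxe, mul_zero])
    rwa [add_zero] at h
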